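/- All matroids are finite, on a ground set $E$; $\operatorname{rk}$ is the rank function, $\mathcal L(\mathsf M)$ is the lattice of flats of $\mathsf M$, and $\mu(\mathsf M)$ is the value of the Möbius function of $\mathcal L(\mathsf M)$ on the interval from the least flat to $E$. The Kazhdan–Lusztig polynomial $P$ and the inverse Kazhdan–Lusztig polynomial $Q$ are the unique assignments of polynomials $P_{\mathsf M}(x),Q_{\mathsf M}(x)\in\mathbb Z[x]$ to loopless matroids $\mathsf M$ such that $P_{\mathsf M}=Q_{\mathsf M}=1$ if $\operatorname{rk}(\mathsf M)=0$, $\deg P_{\mathsf M},\deg Q_{\mathsf M}<\tfrac12\operatorname{rk}(\mathsf M)$ if $\operatorname{rk}(\mathsf M)>0$, and the polynomials $$Z_{\mathsf M}(x)=\sum_{F\in\mathcal L(\mathsf M)}x^{\operatorname{rk}(F)}P_{\mathsf M/F}(x),\qquad Y_{\mathsf M}(x)=\sum_{F\in\mathcal L(\mathsf M)}(-1)^{\operatorname{rk}(\mathsf M)-\operatorname{rk}(F)}\mu(\mathsf M/F)\,x^{\operatorname{rk}(\mathsf M)-\operatorname{rk}(F)}Q_{\mathsf M|_F}(x)$$ are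 palindromic of degree $\operatorname{rk}(\mathsf M)$, that is, invariant under $f(x)\mapsto x^{\operatorname{rk}(\mathsf M)}f(x^{-1})$. The polynomial $Y_{\mathsf M}$ is the inverse $Z$-polynomial. If $\mathsf M$ has loops, put $P_{\mathsf M}=Q_{\mathsf M}=Y_{\mathsf M}=0$. Let $\tau(\mathsf M)$ be the coefficient of $x^{(\operatorname{rk}(\mathsf M)-1)/2}$ in $P_{\mathsf M}(x)$ if $\operatorname{rk}(\mathsf M)$ is odd, and $0$ if it is even. **Theorem.** Let $\mathsf M$ be a loopless matroid on $E$, let $i\in E$ be an element that is not a coloop, and let $\mathcal T_i=\{F\in\mathcal L(\mathsf M): i\in F \text{ and } F\smallsetminus\{i\}\notin\mathcal L(\mathsf M)\}$. Then $$Q_{\mathsf M}(x)=Q_{\mathsf M\smallsetminus i}(x)+(1+x)\,Q_{\mathsf M/i}(x)-\sum_{F\in\mathcal T_i}\tau(\mathsf M|_F/i)\,x^{\operatorname{rk}(F)/2}\,Q_{\mathsf M/F}(x),$$ $$Y_{\mathsf M}(x)=Y_{\mathsf M\smallsetminus i}(x)+(1+x)\,Y_{\mathsf M/i}(x)-\sum_{F\in\mathcal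 T_i}\tau(\mathsf M|_F/i)\,x^{\operatorname{rk}(F)/2}\,Y_{\mathsf M/F}(x).$$ (A summand with $\operatorname{rk}(F)$ odd is zero, since then $\operatorname{rk}(\mathsf M|_F/i)$ is even and $\tau(\mathsf M|_F/i)=0$.) -/

import Mathlib

open Polynomial
open scoped Matroid

namespace Matroid

/-- The rank of a set, as a natural number (used for finite matroids only). -/
noncomputable def rk {α : Type*} (M : Matroid α) (X : Set α) : ℕ := (M.eRk X).toNat

/-- The rank of a matroid, as a natural number (used for finite matroids only). -/
noncomputable def rank {α : Type*} (M : Matroid α) : ℕ := M.eRank.toNat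

theorem finite_setOf_isFlat {α : Type*} (M : Matroid α) [M.Finite] :
    {F : Set α | M.IsFlat F}.Finite :=
  M.ground_finite.finite_subsets.subset fun _ hF => hF.subset_ground

/-- The finite set of all flats of a finite matroid. -/
noncomputable def flats {α : Type*} (M : Matroid α) [M.Finite] : Finset (Set α) :=
  M.finite_setOf_isFlat.toFinset

/-- The lattice of flats, as a type ordered by inclusion. -/
abbrev Flat {α : Type*} (M : Matroid α) : Type _ := {F : Set α // M.IsFlat F}

noncomputable instance {α : Type*} (M : Matroid α) [M.Finite] : Fintype M.Flat :=
  M.finite_setOf_isFlat.fintype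

open scoped Classical in
noncomputable instance {α : Type*} (M : Matroid α) [M.Finite] : LocallyFiniteOrder M.Flat :=
  Fintype.toLocallyFiniteOrder

open scoped Classical in
/-- The Möbius invariant: the Möbius function of the lattice of flats, evaluated at its least
element (the set of loops) and its greatest element (the ground set). -/
noncomputable def mobiusInvariant {α : Type*} (M : Matroid α) [M.Finite] : ℤ :=
  IncidenceAlgebra.mu ℤ (⟨M.closure ∅, M.isFlat_closure ∅⟩ : M.Flat) ⟨M.E, M.ground_isFlat⟩

/-- `p` is palindromic with center of symmetry `n / 2`, that is, `x ^ n * p (x⁻¹) = p (x)`. -/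
def IsPalindromic (n : ℕ) (p : ℤ[X]) : Prop :=
  p.natDegree ≤ n ∧ ∀ j k : ℕ, j + k = n → p.coeff j = p.coeff k

/-- The sum `∑ F, x ^ rk F * P (M / F)` over the flats `F` of `M`. -/
noncomputable def zSum {α : Type*} (P : Matroid α → ℤ[X]) (M : Matroid α) [M.Finite] : ℤ[X] :=
  ∑ F ∈ M.flats, X ^ M.rk F * P (M ／ F)

/-- The sum `∑ F, (-1) ^ (rk M - rk F) * μ (M / F) * x ^ (rk M - rk F) * Q (M | F)` over the
flats `F` of `M`. -/
noncomputable def ySum {α : Type*} (Q : Matroid α → ℤ[X]) (M : Matroid α) [M.Finite] : ℤ[X] :=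
  ∑ F ∈ M.flats,
    C ((-1) ^ (M.rank - M.rk F) * (M ／ F).mobiusInvariant) * X ^ (M.rank - M.rk F) * Q (M ↾ F)

/-- The properties common to the two systems of Kazhdan--Lusztig type polynomials: `P` assigns a
polynomial to each finite loopless matroid (and zero to all others), such that `P` is `1` in rank
zero, has degree less than half of the rank in positive rank, and the polynomial `S P M` derived
from `P` is palindromic, with the rank of `M` as its degree. -/
structure IsKLSystem {α : Type*}
    (S : (Matroid α → ℤ[X]) → (M : Matroid α) → [M.Finite] → ℤ[X]) (P : Matroid α → ℤ[X]) :
    Prop where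
  rank_zero : ∀ (M : Matroid α) [M.Finite] [M.Loopless], M.rank = 0 → P M = 1
  degree_lt : ∀ (M : Matroid α) [M.Finite] [M.Loopless],
    0 < M.rank → 2 * (P M).natDegree < M.rank
  palindromic : ∀ (M : Matroid α) [M.Finite] [M.Loopless], IsPalindromic M.rank (S P M)
  eq_zero : ∀ M : Matroid α, ¬ (M.Finite ∧ M.Loopless) → P M = 0

/-- The correction to a polynomial `R` that makes it palindromic. -/
noncomputable def palindromicCorrection (n : ℕ) (R : ℤ[X]) : ℤ[X] :=
  ∑ k ∈ Finset.range ((n + 1) / 2), C (R.coeff (n - k) - R.coeff k) * X ^ k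

theorem coeff_palindromicCorrection (n : ℕ) (R : ℤ[X]) (j : ℕ) :
    (palindromicCorrection n R).coeff j =
      if 2 * j < n then R.coeff (n - j) - R.coeff j else 0 := by
  have h : j < (n + 1) / 2 ↔ 2 * j < n := by omega
  simp only [palindromicCorrection, finsetSum_coeff, coeff_C_mul, coeff_X_pow, mul_ite, mul_one,
    mul_zero, Finset.sum_ite_eq, Finset.mem_range, h]

theorem two_mul_natDegree_palindromicCorrection {n : ℕ} (hn : 0 < n) (R : ℤ[X]) :
    2 * (palindromicCorrection n R).natDegree < n := by
  by_contra h
  have h0 : (palindromicCorrection n R).natDegree ≠ 0 := by omega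
  have h1 : (palindromicCorrection n R).leadingCoeff ≠ 0 := by
    intro h2
    rw [leadingCoeff_eq_zero] at h2
    simp [h2] at h0
  rw [leadingCoeff, coeff_palindromicCorrection, if_neg h] at h1
  exact h1 rfl

theorem isPalindromic_palindromicCorrection {n : ℕ} (hn : 0 < n) {R : ℤ[X]}
    (hR : R.natDegree ≤ n) : IsPalindromic n (palindromicCorrection n R + R) := by
  refine ⟨(natDegree_add_le _ _).trans (max_le ?_ hR), fun j k hjk => ?_⟩
  · have := two_mul_natDegree_palindromicCorrection hn R
    omega
  · simp only [coeff_add, coeff_palindromicCorrection]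
    obtain h | h | h := lt_trichotomy j k
    · rw [if_pos (by omega), if_neg (by omega), show n - j = k by omega]
      ring
    · rw [h]
    · rw [if_neg (by omega), if_pos (by omega), show n - k = j by omega]
      ring

theorem eq_of_isPalindromic {n : ℕ} {p q R : ℤ[X]} (hp : 2 * p.natDegree < n)
    (hq : 2 * q.natDegree < n) (hpR : IsPalindromic n (p + R)) (hqR : IsPalindromic n (q + R)) :
    p = q := by
  ext j
  by_cases hj : 2 * j < n
  · have h1 := hpR.2 j (n - j) (by omega)
    have h2 := hqR.2 j (n - j) (by omega)
    rw [coeff_add, coeff_add, coeff_eq_zero_of_natDegree_lt (p := p) (n := n - j) (by omega)] at h1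
    rw [coeff_add, coeff_add, coeff_eq_zero_of_natDegree_lt (p := q) (n := n - j) (by omega)] at h2
    linarith
  · rw [coeff_eq_zero_of_natDegree_lt (by omega), coeff_eq_zero_of_natDegree_lt (by omega)]

open scoped Classical in
/-- A recursive construction of a system of Kazhdan--Lusztig type polynomials. -/
noncomputable def klRec {α : Type*}
    (S : (Matroid α → ℤ[X]) → (M : Matroid α) → [M.Finite] → ℤ[X]) (M : Matroid α) : ℤ[X] :=
  if h : M.Finite ∧ M.Loopless then
    if M.rank = 0 then 1 else
      haveI := h.1
      palindromicCorrection M.rank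
        (S (fun N => if _h : N.E.ncard < M.E.ncard then klRec S N else 0) M -
          (fun N => if _h : N.E.ncard < M.E.ncard then klRec S N else 0) M)
  else 0
termination_by M.E.ncard

theorem existsUnique_isKLSystem {α : Type*}
    (S : (Matroid α → ℤ[X]) → (M : Matroid α) → [M.Finite] → ℤ[X])
    (hloc : ∀ (P P' : Matroid α → ℤ[X]) (M : Matroid α) [M.Finite] [M.Loopless],
      (∀ (N : Matroid α) [N.Finite] [N.Loopless], N.E.ncard < M.E.ncard → P N = P' N) →
        S P M - P M = S P' M - P' M)
    (hdeg : ∀ (P : Matroid α → ℤ[X]) (M : Matroid α) [M.Finite] [M.Loopless],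
      (∀ (N : Matroid α) [N.Finite] [N.Loopless], N.E.ncard < M.E.ncard →
        2 * (P N).natDegree ≤ N.rank) → (S P M - P M).natDegree ≤ M.rank)
    (hzero : ∀ (P : Matroid α → ℤ[X]) (M : Matroid α) [M.Finite] [M.Loopless],
      M.rank = 0 → S P M = P M) :
    ∃! P : Matroid α → ℤ[X], IsKLSystem S P := by
  obtain ⟨K, hrec, h0, hz⟩ : ∃ K : Matroid α → ℤ[X],
      (∀ (M : Matroid α) [M.Finite] [M.Loopless], 0 < M.rank →
        K M = palindromicCorrection M.rank (S K M - K M)) ∧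
      (∀ (M : Matroid α) [M.Finite] [M.Loopless], M.rank = 0 → K M = 1) ∧
      (∀ M : Matroid α, ¬ (M.Finite ∧ M.Loopless) → K M = 0) := by
    refine ⟨klRec S, ?_, ?_, ?_⟩
    · intro M _ _ hM
      conv_lhs => rw [klRec, dif_pos ⟨inferInstance, inferInstance⟩, if_neg hM.ne']
      exact congrArg (palindromicCorrection M.rank) (hloc _ _ M fun N _ _ hN => dif_pos hN)
    · intro M _ _ hM
      rw [klRec, dif_pos ⟨inferInstance, inferInstance⟩, if_pos hM]
    · intro M hM
      rw [klRec, dif_neg hM]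
  have hd : ∀ (M : Matroid α) [M.Finite] [M.Loopless],
      0 < M.rank → 2 * (K M).natDegree < M.rank := by
    intro M _ _ hM
    rw [hrec M hM]
    exact two_mul_natDegree_palindromicCorrection hM _
  refine ⟨K, ⟨h0, hd, ?_, ?_⟩, ?_⟩
  · intro M _ _
    obtain hM | hM := Nat.eq_zero_or_pos M.rank
    · rw [hzero _ M hM, h0 M hM, hM]
      refine ⟨by simp, fun j k hjk => ?_⟩
      rw [show j = 0 by omega, show k = 0 by omega]
    · have hR : (S K M - K M).natDegree ≤ M.rank := by
        apply hdeg
        intro N _ _ _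
        obtain hN | hN := Nat.eq_zero_or_pos N.rank
        · simp [h0 N hN]
        · exact (hd N hN).le
      have := isPalindromic_palindromicCorrection hM hR
      rwa [← hrec M hM, add_sub_cancel] at this
  · exact hz
  · intro P hP
    have key : ∀ (n : ℕ) (M : Matroid α) [M.Finite] [M.Loopless], M.E.ncard = n →
        P M = K M := by
      intro n
      induction n using Nat.strong_induction_on with
      | _ n ih =>
        intro M _ _ hn
        obtain hM | hM := Nat.eq_zero_or_pos M.rank
        · rw [hP.rank_zero M hM, h0 M hM]
        · have h1 := hP.palindromic M
          have h2 : S P M - P M = S K M - K M := by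
            apply hloc
            intro N _ _ hN
            exact ih _ (hn ▸ hN) N rfl
          have hR : (S K M - K M).natDegree ≤ M.rank := by
            apply hdeg
            intro N _ _ _
            obtain hN | hN := Nat.eq_zero_or_pos N.rank
            · simp [h0 N hN]
            · exact (hd N hN).le
          have h3 := isPalindromic_palindromicCorrection hM hR
          rw [← hrec M hM] at h3
          refine eq_of_isPalindromic (hP.degree_lt M hM) (hd M hM) ?_ h3
          rwa [← h2, add_sub_cancel]
    funext M
    by_cases h : M.Finite ∧ M.Loopless
    · have := h.1
      have := h.2
      exact key _ M rfl
    · rw [hP.eq_zero M h, hz M h]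

theorem IsFlat.contract_loopless {α : Type*} {M : Matroid α} {F : Set α} (hF : M.IsFlat F) :
    (M ／ F).Loopless := by
  constructor
  rw [contract_loops_eq, hF.closure, Set.sdiff_self]

theorem mem_flats {α : Type*} {M : Matroid α} [M.Finite] {F : Set α} :
    F ∈ M.flats ↔ M.IsFlat F := by
  simp [flats]

theorem rk_add_rank_contract_le {α : Type*} (M : Matroid α) [M.Finite] (F : Set α) :
    M.rk F + (M ／ F).rank ≤ M.rank := by
  obtain ⟨I, hI⟩ := M.exists_isBasis' F
  obtain ⟨B, hB⟩ := (M ／ F).exists_isBase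
  have hIB := (hI.contract_indep_iff.1 hB.indep)
  have hd : Disjoint I B := by
    refine Set.disjoint_of_subset_left hI.subset ?_
    have := hB.subset_ground
    rw [contract_ground, Set.subset_sdiff] at this
    exact this.2.symm
  have h1 := hIB.1.encard_le_eRank
  rw [Set.union_comm, Set.encard_union_eq hd, hI.encard_eq_eRk, hB.encard_eq_eRank] at h1
  have h2 : M.eRank ≠ ⊤ := by
    rw [eRank_ne_top_iff]
    infer_instance
  have h3 := ENat.toNat_le_toNat h1 h2
  rwa [ENat.toNat_add (ne_top_of_le_ne_top h2 (le_self_add.trans h1))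
    (ne_top_of_le_ne_top h2 (le_add_self.trans h1))] at h3

theorem rk_le_rank {α : Type*} (M : Matroid α) [M.Finite] (F : Set α) : M.rk F ≤ M.rank :=
  le_self_add.trans (M.rk_add_rank_contract_le F)

theorem zSum_sub {α : Type*} (P : Matroid α → ℤ[X]) (M : Matroid α) [M.Finite] [M.Loopless] :
    zSum P M - P M = ∑ F ∈ M.flats \ {∅}, X ^ M.rk F * P (M ／ F) := by
  have h : ∅ ∈ M.flats := by
    rw [mem_flats, isFlat_iff_closure_eq]
    exact M.loops_eq_empty
  rw [zSum, ← Finset.sum_sdiff (Finset.singleton_subset_iff.2 h)]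
  simp [rk]

theorem ySum_sub {α : Type*} (Q : Matroid α → ℤ[X]) (M : Matroid α) [M.Finite] :
    ySum Q M - Q M = ∑ F ∈ M.flats \ {M.E},
      C ((-1) ^ (M.rank - M.rk F) * (M ／ F).mobiusInvariant) * X ^ (M.rank - M.rk F) *
        Q (M ↾ F) := by
  have h : M.E ∈ M.flats := mem_flats.2 M.ground_isFlat
  have hr : M.rk M.E = M.rank := by rw [rk, rank, eRk_ground]
  have hm : (M ／ M.E).mobiusInvariant = 1 := by
    have : (⟨(M ／ M.E).closure ∅, (M ／ M.E).isFlat_closure ∅⟩ : (M ／ M.E).Flat) =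
        ⟨(M ／ M.E).E, (M ／ M.E).ground_isFlat⟩ := by
      ext x
      have h1 := (M ／ M.E).closure_subset_ground ∅
      simp only [contract_ground, Set.sdiff_self] at h1 ⊢
      exact ⟨fun h => h1 h, fun h => absurd h (by simp)⟩
    rw [mobiusInvariant, this, IncidenceAlgebra.mu_self]
  rw [ySum, ← Finset.sum_sdiff (Finset.singleton_subset_iff.2 h)]
  simp [hr, hm]

theorem existsUnique_isKLSystem_zSum (α : Type*) :
    ∃! P : Matroid α → ℤ[X], IsKLSystem zSum P := by
  have hcard : ∀ (M : Matroid α) [M.Finite] (F : Set α), F ∈ M.flats \ {∅} →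
      M.IsFlat F ∧ (M ／ F).E.ncard < M.E.ncard := by
    intro M _ F hF
    rw [Finset.mem_sdiff, mem_flats, Finset.mem_singleton] at hF
    refine ⟨hF.1, Set.ncard_lt_ncard ?_ M.ground_finite⟩
    obtain ⟨x, hx⟩ := Set.nonempty_iff_ne_empty.2 hF.2
    rw [contract_ground]
    exact ⟨Set.sdiff_subset, fun h => (h (hF.1.subset_ground hx)).2 hx⟩
  apply existsUnique_isKLSystem
  · intro P P' M _ _ h
    rw [zSum_sub, zSum_sub]
    refine Finset.sum_congr rfl fun F hF => ?_
    have := (hcard M F hF).1.contract_loopless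
    rw [h _ (hcard M F hF).2]
  · intro P M _ _ h
    rw [zSum_sub]
    refine natDegree_sum_le_of_forall_le _ _ fun F hF => ?_
    have := (hcard M F hF).1.contract_loopless
    have h1 := h _ (hcard M F hF).2
    have h2 := M.rk_add_rank_contract_le F
    refine natDegree_mul_le.trans ?_
    rw [natDegree_X_pow]
    omega
  · intro P M _ _ hM
    rw [← sub_eq_zero, zSum_sub]
    have : M.flats \ {∅} = ∅ := by
      rw [Finset.sdiff_eq_empty_iff_subset]
      intro F hF
      have h1 := M.rk_le_rank M.E
      rw [hM, rk, eRk_ground, Nat.le_zero, ENat.toNat_eq_zero] at h1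
      have h2 : M.eRank ≠ ⊤ := by
        rw [eRank_ne_top_iff]
        infer_instance
      have h3 := eRank_eq_zero_iff.1 (h1.resolve_right h2)
      have h4 : (loopyOn M.E).Loopless := h3 ▸ inferInstance
      rw [loopyOn_isLoopless_iff] at h4
      have h5 := (mem_flats.1 hF).subset_ground
      rw [h4, Set.subset_empty_iff] at h5
      simp [h5]
    rw [this, Finset.sum_empty]

theorem existsUnique_isKLSystem_ySum (α : Type*) :
    ∃! Q : Matroid α → ℤ[X], IsKLSystem ySum Q := by
  have hcard : ∀ (M : Matroid α) [M.Finite] [M.Loopless] (F : Set α), F ∈ M.flats \ {M.E} →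
      (M ↾ F).E.ncard < M.E.ncard ∧ (M ↾ F).Finite ∧ (M ↾ F).Loopless := by
    intro M _ _ F hF
    rw [Finset.mem_sdiff, mem_flats, Finset.mem_singleton] at hF
    have h := hF.1.subset_ground
    exact ⟨Set.ncard_lt_ncard (h.ssubset_of_ne hF.2) M.ground_finite,
      ⟨M.ground_finite.subset h⟩, (restrict_isRestriction M F h).loopless⟩
  apply existsUnique_isKLSystem
  · intro P P' M _ _ h
    rw [ySum_sub, ySum_sub]
    refine Finset.sum_congr rfl fun F hF => ?_
    obtain ⟨h1, _, _⟩ := hcard M F hF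
    rw [h _ h1]
  · intro P M _ _ h
    rw [ySum_sub]
    refine natDegree_sum_le_of_forall_le _ _ fun F hF => ?_
    obtain ⟨h1, _, _⟩ := hcard M F hF
    have h2 := h _ h1
    have h3 : (M ↾ F).rank = M.rk F := rfl
    have h4 := M.rk_le_rank F
    refine natDegree_mul_le.trans ?_
    have h5 := natDegree_C_mul_X_pow_le
      ((-1) ^ (M.rank - M.rk F) * (M ／ F).mobiusInvariant) (M.rank - M.rk F)
    omega
  · intro P M _ _ hM
    rw [← sub_eq_zero, ySum_sub]
    have : M.flats \ {M.E} = ∅ := by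
      rw [Finset.sdiff_eq_empty_iff_subset]
      intro F hF
      have h1 := M.rk_le_rank M.E
      rw [hM, rk, eRk_ground, Nat.le_zero, ENat.toNat_eq_zero] at h1
      have h2 : M.eRank ≠ ⊤ := by
        rw [eRank_ne_top_iff]
        infer_instance
      have h3 := eRank_eq_zero_iff.1 (h1.resolve_right h2)
      have h4 : (loopyOn M.E).Loopless := h3 ▸ inferInstance
      rw [loopyOn_isLoopless_iff] at h4
      have h5 := (mem_flats.1 hF).subset_ground
      rw [h4, Set.subset_empty_iff] at h5
      simp [h5, h4]
    rw [this, Finset.sum_empty]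

/-- The Kazhdan--Lusztig polynomial of a finite loopless matroid (zero for other matroids): the
unique assignment `P` with `P M = 1` in rank zero, `deg (P M) < rank M / 2` in positive rank, and
`∑ F, x ^ rk F * P (M / F)` palindromic. -/
noncomputable def klPoly {α : Type*} : Matroid α → ℤ[X] :=
  (existsUnique_isKLSystem_zSum α).choose

/-- The inverse Kazhdan--Lusztig polynomial of a finite loopless matroid (zero for other
matroids): the unique assignment `Q` with `Q M = 1` in rank zero, `deg (Q M) < rank M / 2` in
positive rank, and
`∑ F, (-1) ^ (rk M - rk F) * μ (M / F) * x ^ (rk M - rk F) * Q (M | F)` palindromic. -/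
noncomputable def invKLPoly {α : Type*} : Matroid α → ℤ[X] :=
  (existsUnique_isKLSystem_ySum α).choose

/-- The inverse `Z`-polynomial. It vanishes when the finite matroid `M` has loops, since these lie
in all flats. -/
noncomputable def invZPoly {α : Type*} (M : Matroid α) [M.Finite] : ℤ[X] :=
  ySum invKLPoly M

/-- The coefficient of `x ^ ((rank M - 1) / 2)` in the Kazhdan--Lusztig polynomial of `M` if the
rank of `M` is odd, and zero if it is even. -/
noncomputable def tau {α : Type*} (M : Matroid α) : ℤ :=
  open scoped Classical in if Odd M.rank then (klPoly M).coeff ((M.rank - 1) / 2) else 0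

open scoped Classical in
/-- The flats `F` of `M` that contain `i` and for which `F \ {i}` is not a flat of `M`. -/
noncomputable def tFlats {α : Type*} (M : Matroid α) [M.Finite] (i : α) : Finset (Set α) :=
  M.flats.filter fun F => i ∈ F ∧ ¬ M.IsFlat (F \ {i})

end Matroid

namespace Matroid

variable {α : Type*}

/-! Write Q and Y for `invKLPoly` and `invZPoly`, E for the ground set and T for `M.tFlats i`. Q is
determined by its degree bound and the palindromicity of `ySum`. So if g F = Q(M|F) for all proper
flats F, if g E has small degree, and if replacing Q(M|F) by g F in Y gives a palindromic
polynomial, then Q(M) = g E and the new sum is Y(M) (`invKLPoly_eq_of_isPalindromic`). The theorem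
follows by induction on |E|, with g F the deletion formula of M|F for F in T, and Q(M|F) for the
other flats.

Palindromicity: `sum_yWeight_mul_deletionFormula` identifies the new sum with the right-hand side
for Y, every term of which is palindromic. For this the Möbius invariant is rewritten as an
alternating count of spanning sets, which gives the weights in `ySum` a deletion-contraction rule.
Flats are sorted into those avoiding i, those in which i is a coloop, and those in T; the second
kind needs Q(N) = Q(N/i) for a coloop i of N.

Degree: the only excess in (1+x) Q(M/i) is a coefficient at half the rank of M. The summand F = E
cancels it, because τ is also the middle coefficient of Q (`tau_eq_coeff_invKLPoly`). That comes
from the vanishing of ∑ (-1)^(rk F) Q(M|F) P(M/F), which is palindromic by Möbius inversion but of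
too small degree to be nonzero. -/

/-! ### Ranks of minors -/

theorem IsFlat.closure_subset {M : Matroid α} {F X : Set α} (hF : M.IsFlat F) (hX : X ⊆ F) :
    M.closure X ⊆ F :=
  (M.closure_subset_closure hX).trans hF.closure.subset

theorem eRank_ne_top (M : Matroid α) [M.Finite] : M.eRank ≠ ⊤ := by
  rw [eRank_ne_top_iff]
  infer_instance

theorem rank_contract_add_rk (M : Matroid α) [M.Finite] (X : Set α) :
    (M ／ X).rank + M.rk X = M.rank := by
  refine le_antisymm (by rw [add_comm]; exact M.rk_add_rank_contract_le X) ?_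
  -- A base of the contraction together with X spans M, which gives the missing inequality.
  obtain ⟨B, hB⟩ := (M ／ X).exists_isBase
  have hs := (contract_spanning_iff'.1 hB.spanning).1
  have h1 : M.eRank ≤ (M ／ X).eRank + M.eRk X := by
    rw [← hs.eRk_eq, ← hB.encard_eq_eRank, ← M.eRk_inter_ground X]
    exact M.eRk_union_le_encard_add_eRk _ _
  have h3 : M.eRk X ≠ ⊤ := ne_top_of_le_ne_top M.eRank_ne_top (M.eRk_le_eRank X)
  have h4 := ENat.toNat_le_toNat h1 (by simp [(M ／ X).eRank_ne_top, h3])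
  rwa [ENat.toNat_add (M ／ X).eRank_ne_top h3] at h4

theorem rank_restrict (M : Matroid α) (X : Set α) : (M ↾ X).rank = M.rk X := rfl

theorem rk_restrict (M : Matroid α) {X R : Set α} (h : X ⊆ R) : (M ↾ R).rk X = M.rk X := by
  rw [rk, restrict_eRk_eq _ h, rk]

theorem rk_ground (M : Matroid α) : M.rk M.E = M.rank := by
  rw [rk, rank, eRk_ground]

theorem rk_contract_sdiff_add_rk (M : Matroid α) [M.Finite] {X Y : Set α} (h : X ⊆ Y)
    (hY : Y ⊆ M.E) : (M ／ X).rk (Y \ X) + M.rk X = M.rk Y := by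
  have : (M ↾ Y).Finite := ⟨M.ground_finite.subset hY⟩
  rw [← rank_restrict, ← restrict_contract_eq_contract_restrict _ h, ← M.rk_restrict h,
    rank_contract_add_rk, rank_restrict]

theorem rank_contractElem_add_one (M : Matroid α) [M.Finite] {i : α} (hi : M.IsNonloop i) :
    (M ／ {i}).rank + 1 = M.rank := by
  rw [← M.rank_contract_add_rk {i}, rk, hi.eRk_eq]
  rfl

theorem rank_deleteElem (M : Matroid α) {i : α} (hi : ¬ M.IsColoop i) :
    (M ＼ {i}).rank = M.rank := by
  rw [isColoop_iff_sdiff_not_spanning, not_not] at hi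
  rw [rank, rank, delete_eq_restrict, hi.eRank_restrict]

/-! ### The Möbius invariant as an alternating count of spanning sets -/

open scoped Classical in
/-- The alternating sum over the spanning subsets of a finite matroid (zero for other matroids). -/
noncomputable def signedSpanningCount (M : Matroid α) : ℤ :=
  if h : M.E.Finite then
    ∑ A ∈ h.toFinset.powerset, if M.Spanning (A : Set α) then (-1) ^ A.card else 0
  else 0

open scoped Classical in
theorem signedSpanningCount_eq {M : Matroid α} {s : Finset α} (hs : (s : Set α) = M.E) :
    M.signedSpanningCount =
      ∑ A ∈ s.powerset, if M.Spanning (A : Set α) then (-1) ^ A.card else 0 := by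
  have h : M.E.Finite := hs ▸ s.finite_toSet
  have h' : h.toFinset = s := by simp [← hs]
  rw [signedSpanningCount, dif_pos h, h']

theorem exists_coe_insert_eq_ground (M : Matroid α) [M.Finite] [DecidableEq α] {i : α}
    (hi : i ∈ M.E) :
    ∃ s : Finset α, i ∉ s ∧ ((insert i s : Finset α) : Set α) = M.E ∧
      (s : Set α) = M.E \ {i} := by
  refine ⟨M.ground_finite.toFinset.erase i, by simp, ?_, ?_⟩ <;> simp [hi]

/-- As i is not a coloop, the spanning sets avoiding i are those of the deletion. Those containing i
become spanning sets of the contraction on removing i, with the opposite sign. -/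
theorem signedSpanningCount_deleteElem (M : Matroid α) [M.Finite] {i : α} (hi : i ∈ M.E)
    (hc : ¬ M.IsColoop i) :
    M.signedSpanningCount =
      (M ＼ {i}).signedSpanningCount - (M ／ {i}).signedSpanningCount := by
  classical
  obtain ⟨s, his, h1, h2⟩ := M.exists_coe_insert_eq_ground hi
  rw [signedSpanningCount_eq h1, signedSpanningCount_eq (M := M ＼ {i}) h2,
    signedSpanningCount_eq (M := M ／ {i}) h2, Finset.sum_powerset_insert his, sub_eq_add_neg,
    ← Finset.sum_neg_distrib]
  have hco : M.Coindep {i} := by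
    rw [coindep_iff_compl_spanning (by simpa using hi)]
    rwa [isColoop_iff_sdiff_not_spanning, not_not] at hc
  congr 1 <;> refine Finset.sum_congr rfl fun A hA => ?_
  · have hiA : i ∉ A := fun h => his (Finset.mem_powerset.1 hA h)
    simp [hco.delete_spanning_iff, hiA]
  · have hiA : i ∉ A := fun h => his (Finset.mem_powerset.1 hA h)
    rw [contract_spanning_iff (by simpa using hi), Finset.card_insert_of_notMem hiA]
    simp only [Finset.coe_insert, Set.union_singleton, Set.disjoint_singleton_right,
      Finset.mem_coe, hiA, not_false_iff, and_true]
    split_ifs <;> ring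

theorem IsColoop.signedSpanningCount_eq_neg {M : Matroid α} [M.Finite] {i : α}
    (hc : M.IsColoop i) : M.signedSpanningCount = - (M ／ {i}).signedSpanningCount := by
  classical
  have hi := hc.mem_ground
  obtain ⟨s, his, h1, h2⟩ := M.exists_coe_insert_eq_ground hi
  rw [signedSpanningCount_eq h1,
    signedSpanningCount_eq (M := M ／ {i}) h2, Finset.sum_powerset_insert his,
    ← Finset.sum_neg_distrib, add_eq_right.2]
  · refine Finset.sum_congr rfl fun A hA => ?_
    have hiA : i ∉ A := fun h => his (Finset.mem_powerset.1 hA h)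
    rw [contract_spanning_iff (by simpa using hi), Finset.card_insert_of_notMem hiA]
    simp only [Finset.coe_insert, Set.union_singleton, Set.disjoint_singleton_right,
      Finset.mem_coe, hiA, not_false_iff, and_true]
    split_ifs <;> ring
  · refine Finset.sum_eq_zero fun A hA => if_neg fun h => ?_
    have hiA : i ∉ A := fun h => his (Finset.mem_powerset.1 hA h)
    rw [spanning_iff_closure_eq h.subset_ground] at h
    exact hiA (hc.mem_of_mem_closure (h ▸ hi))

/-- Deleting and contracting a loop give the same matroid, so the two terms cancel. -/
theorem IsLoop.signedSpanningCount_eq_zero {M : Matroid α} [M.Finite] {i : α}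
    (hl : M.IsLoop i) : M.signedSpanningCount = 0 := by
  rw [M.signedSpanningCount_deleteElem hl.mem_ground hl.not_isColoop,
    contract_eq_delete_of_subset_loops (Set.singleton_subset_iff.2 hl), sub_self]

open scoped Classical in
/-- Summing the alternating spanning counts of the lower intervals of the lattice of flats. -/
theorem sum_signedSpanningCount_restrict_contract (M : Matroid α) [M.Finite] {F G : Set α}
    (hF : M.IsFlat F) (hG : M.IsFlat G) (hFG : F ⊆ G) :
    ∑ H ∈ M.flats with F ⊆ H ∧ H ⊆ G, ((M ↾ H) ／ F).signedSpanningCount =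
      if F = G then 1 else 0 := by
  have hfin : (G \ F).Finite := M.ground_finite.subset (Set.sdiff_subset.trans hG.subset_ground)
  set s := hfin.toFinset with hs
  have hmem : ∀ A ∈ s.powerset, (A : Set α) ⊆ G ∧ Disjoint (A : Set α) F := by
    intro A hA
    rw [Finset.mem_powerset, hs, ← Finset.coe_subset, Set.Finite.coe_toFinset,
      Set.subset_sdiff] at hA
    exact hA
  -- Each A ⊆ G \ F is counted only at H = closure (A ∪ F), so the sums over H merge into one
  -- alternating sum over all subsets of G \ F.
  have h1 : ∀ H ∈ M.flats.filter (fun H => F ⊆ H ∧ H ⊆ G),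
      ((M ↾ H) ／ F).signedSpanningCount =
        ∑ A ∈ s.powerset, if M.closure (A ∪ F) = H then (-1) ^ A.card else 0 := by
    intro H hH
    simp only [Finset.mem_filter, mem_flats] at hH
    obtain ⟨hH, hFH, hHG⟩ := hH
    have hfin' : (H \ F).Finite := hfin.subset (Set.sdiff_subset_sdiff_left hHG)
    rw [signedSpanningCount_eq (s := hfin'.toFinset) (by simp)]
    refine Finset.sum_subset_zero_on_sdiff ?_ ?_ ?_
    · rw [Finset.powerset_mono, hs]
      simpa using Set.sdiff_subset_sdiff_left hHG
    · intro A hA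
      rw [Finset.mem_sdiff] at hA
      obtain ⟨hAG, hAF⟩ := hmem A hA.1
      refine if_neg fun h => hA.2 ?_
      rw [Finset.mem_powerset, ← Finset.coe_subset, Set.Finite.coe_toFinset, Set.subset_sdiff]
      refine ⟨?_, hAF⟩
      rw [← h]
      exact Set.subset_union_left.trans (M.subset_closure _
        (Set.union_subset (hAG.trans hG.subset_ground) hF.subset_ground))
    · intro A hA
      rw [Finset.mem_powerset, ← Finset.coe_subset, Set.Finite.coe_toFinset,
        Set.subset_sdiff] at hA
      have hAH : (A : Set α) ∪ F ⊆ H := Set.union_subset hA.1 hFH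
      refine if_congr ?_ rfl rfl
      rw [contract_spanning_iff hFH, and_iff_left hA.2,
        restrict_spanning_iff hAH hH.subset_ground]
      exact ⟨fun h => (hH.closure_subset hAH).antisymm h, fun h => h.ge⟩
  rw [Finset.sum_congr rfl h1, Finset.sum_comm]
  have h2 : ∀ A ∈ s.powerset,
      (∑ H ∈ M.flats with F ⊆ H ∧ H ⊆ G, if M.closure (A ∪ F) = H then (-1 : ℤ) ^ A.card else 0)
        = (-1) ^ A.card := by
    intro A hA
    rw [Finset.sum_ite_eq, if_pos]
    obtain ⟨hAG, -⟩ := hmem A hA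
    simp only [Finset.mem_filter, mem_flats]
    refine ⟨M.isFlat_closure _, ?_, hG.closure_subset (Set.union_subset hAG hFG)⟩
    exact Set.subset_union_right.trans (M.subset_closure _
      (Set.union_subset (hAG.trans hG.subset_ground) hF.subset_ground))
  rw [Finset.sum_congr rfl h2, Finset.sum_powerset_neg_one_pow_card]
  refine if_congr ?_ rfl rfl
  rw [hs, Set.Finite.toFinset_eq_empty, Set.sdiff_eq_empty]
  exact ⟨hFG.antisymm, fun h => h.ge⟩

/-- Both sides, taken on all lower intervals [∅, G], satisfy the defining recursion of the Möbius
function; induct on G. -/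
theorem mobiusInvariant_eq_signedSpanningCount (M : Matroid α) [M.Finite] [M.Loopless] :
    M.mobiusInvariant = M.signedSpanningCount := by
  classical
  have h0 : M.closure ∅ = ∅ := M.loops_eq_empty
  have hE : M.IsFlat ∅ := h0 ▸ M.isFlat_closure ∅
  have key : ∀ G : M.Flat, IncidenceAlgebra.mu ℤ (⟨∅, hE⟩ : M.Flat) G =
      ((M ↾ (G : Set α)) ／ ∅).signedSpanningCount := by
    intro G
    induction G using WellFoundedLT.induction with
    | _ G ih =>
    have h1 := IncidenceAlgebra.sum_Icc_mu_right (𝕜 := ℤ) (⟨∅, hE⟩ : M.Flat) G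
    have h2 := M.sum_signedSpanningCount_restrict_contract hE G.2 (Set.empty_subset _)
    have h3 : ∑ H ∈ M.flats with ∅ ⊆ H ∧ H ⊆ (G : Set α),
        ((M ↾ H) ／ ∅).signedSpanningCount =
        ∑ H ∈ Finset.Icc (⟨∅, hE⟩ : M.Flat) G,
          ((M ↾ (H : Set α)) ／ ∅).signedSpanningCount := by
      symm
      refine Finset.sum_bij (fun H _ => (H : Set α)) ?_ ?_ ?_ ?_
      · intro H hH
        simp only [Finset.mem_filter, mem_flats, Finset.mem_Icc] at hH ⊢
        exact ⟨H.2, hH.1, hH.2⟩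
      · intro H _ H' _ h
        exact Subtype.ext h
      · intro H hH
        simp only [Finset.mem_filter, mem_flats] at hH
        exact ⟨⟨H, hH.1⟩, Finset.mem_Icc.2 ⟨hH.2.1, hH.2.2⟩, rfl⟩
      · intro H _
        rfl
    have h4 : (∅ : Set α) = G ↔ (⟨∅, hE⟩ : M.Flat) = G := by
      rw [Subtype.ext_iff]
    have hle : (⟨∅, hE⟩ : M.Flat) ≤ G := Set.empty_subset _
    rw [h3, if_congr h4 rfl rfl, ← h1, ← Finset.Ico_insert_right hle,
      Finset.sum_insert (by simp), Finset.sum_insert (by simp),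
      Finset.sum_congr rfl fun H hH => ih H (Finset.mem_Ico.1 hH).2] at h2
    exact (add_right_cancel h2).symm
  have h := key ⟨M.E, M.ground_isFlat⟩
  rw [contract_empty, restrict_ground_eq_self] at h
  have h5 : (⟨M.closure ∅, M.isFlat_closure ∅⟩ : M.Flat) = ⟨∅, hE⟩ := Subtype.ext h0
  rw [← h, mobiusInvariant, h5]

/-! ### Flats of minors -/

theorem isFlat_contract_iff {M : Matroid α} {C F : Set α} (hC : C ⊆ M.E) :
    (M ／ C).IsFlat F ↔ M.IsFlat (F ∪ C) ∧ Disjoint F C := by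
  rw [isFlat_iff_closure_eq, isFlat_iff_closure_eq, contract_closure_eq]
  have h : C ⊆ M.closure (F ∪ C) := M.subset_closure_of_subset' Set.subset_union_right hC
  constructor
  · intro hF
    have hd : Disjoint F C := hF ▸ Set.disjoint_sdiff_left
    refine ⟨?_, hd⟩
    conv_rhs => rw [← hF]
    rw [Set.sdiff_union_of_subset h]
  · rintro ⟨hF, hd⟩
    rw [hF, Set.union_sdiff_right, hd.sdiff_eq_left]

theorem IsFlat.isFlat_restrict_iff {M : Matroid α} {H F : Set α} (hH : M.IsFlat H) :
    (M ↾ H).IsFlat F ↔ M.IsFlat F ∧ F ⊆ H := by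
  constructor
  · intro hF
    have hs : F ⊆ H := hF.subset_ground
    rw [isFlat_iff_closure_eq, restrict_closure_eq _ hs hH.subset_ground,
      Set.inter_eq_left.2 (hH.closure_subset hs)] at hF
    exact ⟨isFlat_iff_closure_eq.2 hF, hs⟩
  · rintro ⟨hF, hs⟩
    rw [isFlat_iff_closure_eq, restrict_closure_eq _ hs hH.subset_ground, hF.closure,
      Set.inter_eq_left.2 hs]

theorem isFlat_deleteElem_iff {M : Matroid α} {i : α} {F : Set α} :
    (M ＼ {i}).IsFlat F ↔ i ∉ F ∧ M.closure F \ {i} = F := by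
  rw [isFlat_iff_closure_eq]
  constructor
  · intro h
    have hi : i ∉ F := by
      rw [← h, delete_closure_eq]
      simp
    rw [delete_closure_eq_of_disjoint _ (by simpa using hi)] at h
    exact ⟨hi, h⟩
  · rintro ⟨hi, h⟩
    rwa [delete_closure_eq_of_disjoint _ (by simpa using hi)]

theorem mem_tFlats {M : Matroid α} [M.Finite] {i : α} {F : Set α} :
    F ∈ M.tFlats i ↔ M.IsFlat F ∧ i ∈ F ∧ ¬ M.IsFlat (F \ {i}) := by
  simp [tFlats, mem_flats]

/-- The closure stays inside F, so the only element it can gain is i, and it must gain one. -/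
theorem closure_sdiff_singleton_eq {M : Matroid α} {i : α} {F : Set α} (hF : M.IsFlat F)
    (hF' : ¬ M.IsFlat (F \ {i})) : M.closure (F \ {i}) = F := by
  have h1 : F \ {i} ⊆ M.closure (F \ {i}) :=
    M.subset_closure _ (Set.sdiff_subset.trans hF.subset_ground)
  have h2 : M.closure (F \ {i}) ⊆ F := hF.closure_subset Set.sdiff_subset
  refine h2.antisymm fun x hx => ?_
  by_cases hxi : x = i
  · by_contra h
    refine hF' (isFlat_iff_closure_eq.2 (subset_antisymm (fun y hy => ⟨h2 hy, ?_⟩) h1))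
    rintro rfl
    exact h (hxi ▸ hy)
  · exact h1 ⟨hx, hxi⟩

/-- Thus `tFlats` consists of the flats F containing i as a non-coloop of M|F, exactly those to
which the deletion formula applies. -/
theorem isColoop_restrict_iff_isFlat_sdiff {M : Matroid α} {i : α} {F : Set α} (hF : M.IsFlat F)
    (hi : i ∈ F) : (M ↾ F).IsColoop i ↔ M.IsFlat (F \ {i}) := by
  rw [restrict_isColoop_iff hF.subset_ground, and_iff_left hi]
  constructor
  · intro h
    by_contra h'
    rw [closure_sdiff_singleton_eq hF h'] at h
    exact h hi
  · intro h
    rw [h.closure]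
    simp

/-! ### Sums over flats, sorted by their relation to i -/

section sums

variable {β : Type*} [AddCommMonoid β]

open scoped Classical in
theorem sum_flats_contract (M : Matroid α) [M.Finite] {C : Set α} (hC : C ⊆ M.E)
    (f : Set α → β) :
    ∑ F ∈ (M ／ C).flats, f F = ∑ F ∈ M.flats with C ⊆ F, f (F \ C) := by
  refine Finset.sum_bij' (fun F _ => F ∪ C) (fun F _ => F \ C) ?_ ?_ ?_ ?_ ?_
  · intro F hF
    rw [mem_flats, isFlat_contract_iff hC] at hF
    simpa [mem_flats] using hF.1
  · intro F hF
    simp only [Finset.mem_filter, mem_flats] at hF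
    rw [mem_flats, isFlat_contract_iff hC, Set.sdiff_union_of_subset hF.2]
    exact ⟨hF.1, Set.disjoint_sdiff_left⟩
  · intro F hF
    rw [mem_flats, isFlat_contract_iff hC] at hF
    rw [Set.union_sdiff_right, hF.2.sdiff_eq_left]
  · intro F hF
    simp only [Finset.mem_filter] at hF
    exact Set.sdiff_union_of_subset hF.2
  · intro F hF
    rw [mem_flats, isFlat_contract_iff hC] at hF
    rw [Set.union_sdiff_right, hF.2.sdiff_eq_left]

open scoped Classical in
theorem IsFlat.flats_restrict {M : Matroid α} [M.Finite] {H : Set α} (hH : M.IsFlat H)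
    [(M ↾ H).Finite] : (M ↾ H).flats = M.flats.filter (· ⊆ H) := by
  ext F
  simp [mem_flats, hH.isFlat_restrict_iff]

open scoped Classical in
theorem IsFlat.tFlats_restrict {M : Matroid α} [M.Finite] {H : Set α} (hH : M.IsFlat H)
    [(M ↾ H).Finite] (i : α) : (M ↾ H).tFlats i = (M.tFlats i).filter (· ⊆ H) := by
  ext F
  simp only [Finset.mem_filter, mem_tFlats, hH.isFlat_restrict_iff]
  constructor
  · rintro ⟨⟨h1, h2⟩, h3, h4⟩
    exact ⟨⟨h1, h3, fun h => h4 ⟨h, Set.sdiff_subset.trans h2⟩⟩, h2⟩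
  · rintro ⟨⟨h1, h2, h3⟩, h4⟩
    exact ⟨⟨h1, h4⟩, h2, fun h => h3 h.1⟩

open scoped Classical in
-- A flat of the deletion that is not a flat of M gains exactly i under closure in M, and its
-- closure lies in `tFlats`.
theorem sum_flats_deleteElem (M : Matroid α) [M.Finite] (i : α) (f : Set α → β) :
    ∑ F ∈ (M ＼ {i}).flats, f F =
      ∑ F ∈ M.flats with i ∉ F, f F + ∑ F ∈ M.tFlats i, f (F \ {i}) := by
  rw [← Finset.sum_filter_add_sum_filter_not (M ＼ {i}).flats M.IsFlat]
  congr 1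
  · refine Finset.sum_congr ?_ fun _ _ => rfl
    ext F
    simp only [Finset.mem_filter, mem_flats, isFlat_deleteElem_iff]
    constructor
    · rintro ⟨⟨h1, -⟩, h2⟩
      exact ⟨h2, h1⟩
    · rintro ⟨h1, h2⟩
      exact ⟨⟨h2, by rw [h1.closure, Set.sdiff_singleton_eq_self h2]⟩, h1⟩
  · refine Finset.sum_bij' (fun F _ => M.closure F) (fun F _ => F \ {i}) ?_ ?_ ?_ ?_ ?_
    · intro F hF
      simp only [Finset.mem_filter, mem_flats, isFlat_deleteElem_iff] at hF
      obtain ⟨⟨h1, h2⟩, h3⟩ := hF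
      rw [mem_tFlats, h2]
      refine ⟨M.isFlat_closure F, ?_, h3⟩
      by_contra h
      rw [Set.sdiff_singleton_eq_self h] at h2
      exact h3 (isFlat_iff_closure_eq.2 h2)
    · intro F hF
      rw [mem_tFlats] at hF
      simp [mem_flats, isFlat_deleteElem_iff, closure_sdiff_singleton_eq hF.1 hF.2.2, hF.2.2]
    · intro F hF
      simp only [Finset.mem_filter, mem_flats, isFlat_deleteElem_iff] at hF
      exact hF.1.2
    · intro F hF
      rw [mem_tFlats] at hF
      exact closure_sdiff_singleton_eq hF.1 hF.2.2
    · intro F hF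
      simp only [Finset.mem_filter, mem_flats, isFlat_deleteElem_iff] at hF
      rw [hF.1.2]

open scoped Classical in
theorem sum_flats_eq_add_add (M : Matroid α) [M.Finite] (i : α) (f : Set α → β) :
    ∑ F ∈ M.flats, f F = ∑ F ∈ M.flats with i ∉ F, f F +
      ∑ F ∈ M.flats with i ∈ F ∧ M.IsFlat (F \ {i}), f F + ∑ F ∈ M.tFlats i, f F := by
  rw [← Finset.sum_filter_add_sum_filter_not M.flats (i ∈ ·),
    ← Finset.sum_filter_add_sum_filter_not (M.flats.filter (i ∈ ·)) (fun F => M.IsFlat (F \ {i})),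
    Finset.filter_filter, Finset.filter_filter, tFlats, add_comm, add_assoc]

open scoped Classical in
theorem sum_flats_mem_eq_add (M : Matroid α) [M.Finite] (i : α) (f : Set α → β) :
    ∑ F ∈ M.flats with i ∈ F, f F =
      ∑ F ∈ M.flats with i ∈ F ∧ M.IsFlat (F \ {i}), f F + ∑ F ∈ M.tFlats i, f F := by
  rw [← Finset.sum_filter_add_sum_filter_not (M.flats.filter (i ∈ ·))
    (fun F => M.IsFlat (F \ {i})), Finset.filter_filter, Finset.filter_filter, tFlats]

open scoped Classical in
theorem sum_flats_sdiff_eq_sum_flats_insert (M : Matroid α) [M.Finite] (i : α)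
    (f : Set α → β) :
    ∑ F ∈ M.flats with i ∈ F ∧ M.IsFlat (F \ {i}), f F =
      ∑ F ∈ M.flats with i ∉ F ∧ M.IsFlat (insert i F), f (insert i F) := by
  refine Finset.sum_bij' (fun F _ => F \ {i}) (fun F _ => insert i F) ?_ ?_ ?_ ?_ ?_
  · intro F hF
    simp only [Finset.mem_filter, mem_flats] at hF ⊢
    rw [Set.insert_sdiff_self_of_mem hF.2.1]
    exact ⟨hF.2.2, by simp, hF.1⟩
  · intro F hF
    simp only [Finset.mem_filter, mem_flats] at hF ⊢
    rw [Set.insert_sdiff_self_of_notMem hF.2.1]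
    exact ⟨hF.2.2, by simp, hF.1⟩
  · intro F hF
    simp only [Finset.mem_filter, mem_flats] at hF
    exact Set.insert_sdiff_self_of_mem hF.2.1
  · intro F hF
    simp only [Finset.mem_filter, mem_flats] at hF
    exact Set.insert_sdiff_self_of_notMem hF.2.1
  · intro F hF
    simp only [Finset.mem_filter, mem_flats] at hF
    rw [Set.insert_sdiff_self_of_mem hF.2.1]

end sums

/-! ### The weights in `ySum` -/

/-- The coefficient of `Q (M | F)` in `ySum Q M`, as a function of the matroid `N = M / F`. -/
noncomputable def yWeight (N : Matroid α) : ℤ[X] :=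
  C ((-1) ^ N.rank * N.signedSpanningCount) * X ^ N.rank

theorem ySum_eq_sum_yWeight (Q : Matroid α → ℤ[X]) (M : Matroid α) [M.Finite] :
    ySum Q M = ∑ F ∈ M.flats, (M ／ F).yWeight * Q (M ↾ F) := by
  refine Finset.sum_congr rfl fun F hF => ?_
  have := (mem_flats.1 hF).contract_loopless
  rw [yWeight, mobiusInvariant_eq_signedSpanningCount, ← M.rank_contract_add_rk F,
    Nat.add_sub_cancel]

theorem IsLoop.yWeight_eq_zero {M : Matroid α} [M.Finite] {i : α} (hl : M.IsLoop i) :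
    M.yWeight = 0 := by
  simp [yWeight, hl.signedSpanningCount_eq_zero]

theorem IsColoop.yWeight_eq {M : Matroid α} [M.Finite] {i : α} (hc : M.IsColoop i) :
    M.yWeight = X * (M ／ {i}).yWeight := by
  rw [yWeight, yWeight, hc.signedSpanningCount_eq_neg,
    ← M.rank_contractElem_add_one hc.isNonloop]
  simp only [C_mul, C_neg, C_pow, C_1]
  ring

/-- Deletion keeps the rank and contraction lowers it by one. The resulting sign cancels the minus
in the recursion for the count, and a factor X remains. -/
theorem IsNonloop.yWeight_eq {M : Matroid α} [M.Finite] {i : α} (hi : M.IsNonloop i)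
    (hc : ¬ M.IsColoop i) : M.yWeight = (M ＼ {i}).yWeight + X * (M ／ {i}).yWeight := by
  rw [yWeight, yWeight, yWeight, M.signedSpanningCount_deleteElem hi.mem_ground hc,
    rank_deleteElem M hc, ← M.rank_contractElem_add_one hi]
  simp only [C_mul, C_sub, C_neg, C_pow, C_1]
  ring

theorem ground_mem_flats (M : Matroid α) [M.Finite] : M.E ∈ M.flats :=
  mem_flats.2 M.ground_isFlat

theorem yWeight_contract_ground (M : Matroid α) : (M ／ M.E).yWeight = 1 := by
  have h : (M ／ M.E).E = ∅ := by simp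
  have h1 : (M ／ M.E).eRank = 0 := by
    rw [← eRk_ground, h, eRk_empty]
  have h2 : (M ／ M.E).Spanning ∅ := by
    rw [← h]
    exact ground_spanning _
  have h3 : (M ／ M.E).signedSpanningCount = 1 := by
    rw [signedSpanningCount_eq (s := ∅) (by rw [h, Finset.coe_empty])]
    simp [h2]
  simp [yWeight, h3, rank, h1]

/-! ### Palindromic polynomials -/

theorem isPalindromic_iff_reflect_eq {n : ℕ} {p : ℤ[X]} :
    IsPalindromic n p ↔ p.natDegree ≤ n ∧ p.reflect n = p := by
  refine and_congr_right fun hp => ⟨fun h => ?_, fun h j k hjk => ?_⟩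
  · ext j
    rw [coeff_reflect]
    by_cases hj : j ≤ n
    · rw [revAt_le hj]
      exact h _ _ (Nat.sub_add_cancel hj)
    · rw [revAt_eq_self_of_lt (not_le.1 hj)]
  · conv_lhs => rw [← h]
    rw [coeff_reflect, revAt_le (by omega)]
    congr 1
    omega

namespace IsPalindromic

variable {m n : ℕ} {p q : ℤ[X]}

theorem mul (hp : IsPalindromic m p) (hq : IsPalindromic n q) : IsPalindromic (m + n) (p * q) := by
  rw [isPalindromic_iff_reflect_eq] at *
  refine ⟨natDegree_mul_le.trans (add_le_add hp.1 hq.1), ?_⟩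
  rw [reflect_mul _ _ hp.1 hq.1, hp.2, hq.2]

theorem add (hp : IsPalindromic n p) (hq : IsPalindromic n q) : IsPalindromic n (p + q) :=
  ⟨(natDegree_add_le _ _).trans (max_le hp.1 hq.1), fun j k h => by
    rw [coeff_add, coeff_add, hp.2 j k h, hq.2 j k h]⟩

theorem neg (hp : IsPalindromic n p) : IsPalindromic n (-p) :=
  ⟨by rw [natDegree_neg]; exact hp.1, fun j k h => by rw [coeff_neg, coeff_neg, hp.2 j k h]⟩

theorem sub (hp : IsPalindromic n p) (hq : IsPalindromic n q) : IsPalindromic n (p - q) :=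
  sub_eq_add_neg p q ▸ hp.add hq.neg

theorem zero : IsPalindromic n 0 := ⟨by simp, by simp⟩

theorem sum {ι : Type*} {s : Finset ι} {f : ι → ℤ[X]} (h : ∀ i ∈ s, IsPalindromic n (f i)) :
    IsPalindromic n (∑ i ∈ s, f i) :=
  Finset.sum_induction f (IsPalindromic n) (fun _ _ => add) zero h

theorem C (a : ℤ) : IsPalindromic 0 (Polynomial.C a) :=
  ⟨by simp, fun j k h => by rw [show j = 0 by omega, show k = 0 by omega]⟩

theorem X_pow (k : ℕ) : IsPalindromic (2 * k) (X ^ k : ℤ[X]) := by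
  refine ⟨by rw [natDegree_X_pow]; omega, fun i j h => ?_⟩
  rw [coeff_X_pow, coeff_X_pow]
  exact if_congr (by omega) rfl rfl

theorem one_add_X : IsPalindromic 1 (1 + X : ℤ[X]) := by
  refine ⟨by rw [add_comm, ← C_1, natDegree_X_add_C], fun i j h => ?_⟩
  obtain ⟨rfl, rfl⟩ | ⟨rfl, rfl⟩ : i = 0 ∧ j = 1 ∨ i = 1 ∧ j = 0 := by omega
  all_goals simp [coeff_one, coeff_X]

theorem eq_zero_of_two_mul_natDegree_lt (hp : IsPalindromic n p) (h : 2 * p.natDegree < n) :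
    p = 0 :=
  eq_of_isPalindromic (R := 0) h (by rw [natDegree_zero]; omega) (by rwa [add_zero])
    (by rw [add_zero]; exact zero)

end IsPalindromic

/-! ### The pairing of P and Q, and τ as a coefficient of Q -/

theorem isKLSystem_klPoly (α : Type*) : IsKLSystem zSum (klPoly : Matroid α → ℤ[X]) :=
  (existsUnique_isKLSystem_zSum α).choose_spec.1

theorem isKLSystem_invKLPoly (α : Type*) : IsKLSystem ySum (invKLPoly : Matroid α → ℤ[X]) :=
  (existsUnique_isKLSystem_ySum α).choose_spec.1

theorem finite_restrict (M : Matroid α) [M.Finite] {F : Set α} (hF : F ⊆ M.E) : (M ↾ F).Finite :=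
  ⟨M.ground_finite.subset hF⟩

theorem loopless_restrict (M : Matroid α) [M.Loopless] {F : Set α} (hF : F ⊆ M.E) :
    (M ↾ F).Loopless :=
  (restrict_isRestriction M F hF).loopless

theorem contract_contract_sdiff (M : Matroid α) {F G : Set α} (h : F ⊆ G) :
    M ／ F ／ (G \ F) = M ／ G := by
  rw [contract_contract, Set.union_sdiff_cancel h]

open scoped Classical in
theorem zSum_contract (P : Matroid α → ℤ[X]) (M : Matroid α) [M.Finite] {H : Set α}
    (hH : H ⊆ M.E) :
    zSum P (M ／ H) = ∑ G ∈ M.flats with H ⊆ G, X ^ (M ／ H).rk (G \ H) * P (M ／ G) := by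
  rw [zSum, sum_flats_contract M hH]
  refine Finset.sum_congr rfl fun G hG => ?_
  rw [contract_contract_sdiff M (Finset.mem_filter.1 hG).2]

open scoped Classical in
theorem ySum_restrict (Q : Matroid α → ℤ[X]) (M : Matroid α) [M.Finite] {H : Set α}
    (hH : M.IsFlat H) [(M ↾ H).Finite] :
    ySum Q (M ↾ H) = ∑ F ∈ M.flats with F ⊆ H, ((M ↾ H) ／ F).yWeight * Q (M ↾ F) := by
  rw [ySum_eq_sum_yWeight, hH.flats_restrict]
  refine Finset.sum_congr rfl fun F hF => ?_
  rw [restrict_restrict_eq M (Finset.mem_filter.1 hF).2]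

open scoped Classical in
-- Expanding gives a sum over chains F ⊆ H ⊆ G in which the total sign and power of X depend only on
-- F and G. Möbius inversion over H then leaves F = G. The function `Y` stands in for `ySum`, which
-- needs a finiteness instance unavailable for an arbitrary set H.
theorem sum_ySum_mul_zSum (P Q : Matroid α → ℤ[X]) (M : Matroid α) [M.Finite]
    (Y : Set α → ℤ[X]) (hY : ∀ H (hH : M.IsFlat H),
      Y H = @ySum _ Q (M ↾ H) (M.finite_restrict hH.subset_ground)) :
    ∑ H ∈ M.flats, C ((-1) ^ M.rk H) * (Y H * zSum P (M ／ H)) =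
      ∑ F ∈ M.flats, C ((-1) ^ M.rk F) * (Q (M ↾ F) * P (M ／ F)) := by
  have h1 : ∀ H ∈ M.flats, C ((-1) ^ M.rk H) * (Y H * zSum P (M ／ H)) =
      ∑ F ∈ M.flats, ∑ G ∈ M.flats, if F ⊆ H ∧ H ⊆ G then
        C ((M ↾ H) ／ F).signedSpanningCount *
          (C ((-1) ^ M.rk F) * X ^ (M.rk G - M.rk F) * (Q (M ↾ F) * P (M ／ G))) else 0 := by
    intro H hH
    rw [mem_flats] at hH
    have := M.finite_restrict hH.subset_ground
    rw [hY H hH, ySum_restrict Q M hH, zSum_contract P M hH.subset_ground,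
      Finset.sum_mul_sum, Finset.mul_sum, Finset.sum_filter]
    refine Finset.sum_congr rfl fun F hF => ?_
    split_ifs with hFH
    · rw [Finset.mul_sum, Finset.sum_filter]
      refine Finset.sum_congr rfl fun G hG => ?_
      simp only [hFH, true_and]
      split_ifs with hHG
      · have h2 := (M ↾ H).rank_contract_add_rk F
        have h3 := M.rk_contract_sdiff_add_rk hHG (mem_flats.1 hG).subset_ground
        rw [rank_restrict, M.rk_restrict hFH] at h2
        have h4 : M.rk G - M.rk F = ((M ↾ H) ／ F).rank + (M ／ H).rk (G \ H) := by omega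
        have h5 : ((-1 : ℤ[X]) ^ ((M ↾ H) ／ F).rank) * (-1) ^ ((M ↾ H) ／ F).rank = 1 := by
          rw [← mul_pow]
          simp
        rw [yWeight, h4, ← h2]
        simp only [C_mul, C_pow, C_neg, C_1, pow_add]
        linear_combination (C ((M ↾ H) ／ F).signedSpanningCount * (-1) ^ M.rk F *
          (X ^ ((M ↾ H) ／ F).rank * X ^ (M ／ H).rk (G \ H)) * (Q (M ↾ F) * P (M ／ G))) * h5
      · rfl
    · simp [hFH]
  rw [Finset.sum_congr rfl h1, Finset.sum_comm]
  refine Finset.sum_congr rfl fun F hF => ?_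
  rw [Finset.sum_comm]
  have h2 : ∀ G ∈ M.flats, (∑ H ∈ M.flats, if F ⊆ H ∧ H ⊆ G then
        C ((M ↾ H) ／ F).signedSpanningCount *
          (C ((-1) ^ M.rk F) * X ^ (M.rk G - M.rk F) * (Q (M ↾ F) * P (M ／ G))) else 0) =
      if F = G then C ((-1) ^ M.rk F) * (Q (M ↾ F) * P (M ／ F)) else 0 := by
    intro G hG
    rw [← Finset.sum_filter]
    by_cases hFG : F ⊆ G
    · rw [← Finset.sum_mul, ← map_sum, M.sum_signedSpanningCount_restrict_contract
        (mem_flats.1 hF) (mem_flats.1 hG) hFG]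
      split_ifs with h
      · subst h
        simp
      · simp
    · rw [if_neg fun h => hFG h.le, Finset.sum_eq_zero]
      intro H hH
      exact absurd ((Finset.mem_filter.1 hH).2.1.trans (Finset.mem_filter.1 hH).2.2) hFG
  rw [Finset.sum_congr rfl h2, Finset.sum_ite_eq, if_pos hF]

theorem rank_pos (M : Matroid α) [M.Finite] {i : α} (hi : M.IsNonloop i) : 0 < M.rank := by
  have := M.rank_contractElem_add_one hi
  omega

theorem rk_pos (M : Matroid α) [M.Finite] [M.Loopless] {F : Set α} (hF : F ⊆ M.E)
    (hne : F ≠ ∅) : 0 < M.rk F := by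
  obtain ⟨i, hi⟩ := Set.nonempty_iff_ne_empty.2 hne
  have := M.finite_restrict hF
  have := M.loopless_restrict hF
  exact (M ↾ F).rank_pos (i := i) ((M ↾ F).isNonloop_of_loopless hi)

theorem IsFlat.rank_contract_pos {M : Matroid α} [M.Finite] {F : Set α} (hF : M.IsFlat F)
    (hne : F ≠ M.E) : 0 < (M ／ F).rank := by
  have := hF.contract_loopless
  obtain ⟨i, hi, hiF⟩ := Set.exists_of_ssubset (hF.subset_ground.ssubset_of_ne hne)
  exact (M ／ F).rank_pos (i := i) ((M ／ F).isNonloop_of_loopless ⟨hi, hiF⟩)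

/-- The truncated subtraction makes the bound cover rank zero as well. -/
theorem IsKLSystem.two_mul_natDegree_le
    {S : (Matroid α → ℤ[X]) → (M : Matroid α) → [M.Finite] → ℤ[X]} {P : Matroid α → ℤ[X]}
    (hP : IsKLSystem S P) (M : Matroid α) [M.Finite] [M.Loopless] :
    2 * (P M).natDegree ≤ M.rank - 1 := by
  obtain h | h := Nat.eq_zero_or_pos M.rank
  · simp [hP.rank_zero M h]
  · have := hP.degree_lt M h
    omega

/-- The sum is also the alternating sum of the products Y(M|H) Z(M/H), hence palindromic for the
rank of M, while its degree is below half of that rank. -/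
theorem sum_invKLPoly_mul_klPoly (M : Matroid α) [M.Finite] [M.Loopless] (hM : 0 < M.rank) :
    ∑ F ∈ M.flats, C ((-1) ^ M.rk F) * ((M ↾ F).invKLPoly * (M ／ F).klPoly) = 0 := by
  have hfl : ∀ F ∈ M.flats, (M ↾ F).Finite ∧ (M ↾ F).Loopless ∧ (M ／ F).Loopless := by
    intro F hF
    rw [mem_flats] at hF
    exact ⟨M.finite_restrict hF.subset_ground, M.loopless_restrict hF.subset_ground,
      hF.contract_loopless⟩
  refine IsPalindromic.eq_zero_of_two_mul_natDegree_lt (n := M.rank) ?_ ?_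
  · classical
    rw [← sum_ySum_mul_zSum klPoly invKLPoly M (fun H => if h : (M ↾ H).Finite then
      ySum invKLPoly (M ↾ H) else 0) fun H hH => dif_pos (M.finite_restrict hH.subset_ground)]
    refine IsPalindromic.sum fun H hH => ?_
    obtain ⟨h1, h2, h3⟩ := hfl H hH
    rw [dif_pos h1, ← M.rank_contract_add_rk H, add_comm, ← zero_add (M.rk H + _)]
    exact (IsPalindromic.C _).mul (((isKLSystem_invKLPoly α).palindromic (M ↾ H)).mul
      ((isKLSystem_klPoly α).palindromic (M ／ H)))
  · refine (Nat.mul_le_mul_left 2 (natDegree_sum_le_of_forall_le (n := (M.rank - 1) / 2) _ _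
      fun F hF => ?_)).trans_lt (by omega)
    obtain ⟨h1, h2, h3⟩ := hfl F hF
    have h4 := (isKLSystem_invKLPoly α).two_mul_natDegree_le (M ↾ F)
    have h5 := (isKLSystem_klPoly α).two_mul_natDegree_le (M ／ F)
    have h6 := M.rank_contract_add_rk F
    have h7 := natDegree_mul_le (p := (M ↾ F).invKLPoly) (q := (M ／ F).klPoly)
    rw [rank_restrict] at h4
    refine (natDegree_C_mul_le _ _).trans ?_
    omega

theorem tau_eq_coeff_invKLPoly (M : Matroid α) [M.Finite] [M.Loopless] (hM : Odd M.rank) :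
    M.tau = M.invKLPoly.coeff ((M.rank - 1) / 2) := by
  classical
  have hpos := hM.pos
  have h := congrArg (fun p => coeff p ((M.rank - 1) / 2)) (M.sum_invKLPoly_mul_klPoly hpos)
  have he : ∅ ∈ M.flats := by
    rw [mem_flats, isFlat_iff_closure_eq]
    exact M.loops_eq_empty
  have hne : ∅ ≠ M.E := by
    intro h0
    have := M.rk_ground
    rw [← h0, rk, eRk_empty] at this
    simp at this
    omega
  simp only [finsetSum_coeff, coeff_C_mul, coeff_zero] at h
  -- Only F = E and F = ∅ reach the middle coefficient: they give that of Q with sign -1 (odd rank)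
  -- and that of P with sign +1.
  rw [← Finset.add_sum_erase _ _ M.ground_mem_flats,
    ← Finset.add_sum_erase _ _ (Finset.mem_erase.2 ⟨hne, he⟩), Finset.sum_eq_zero, rk_ground,
    hM.neg_one_pow, restrict_ground_eq_self, contract_empty] at h
  · have h1 := M.ground_isFlat.contract_loopless
    have h2 := M.loopless_restrict (Set.empty_subset M.E)
    have h3 := M.finite_restrict (Set.empty_subset M.E)
    have h4 : M.rk ∅ = 0 := by simp [rk]
    have h5 := M.rank_contract_add_rk M.E
    rw [rk_ground] at h5
    rw [(isKLSystem_klPoly α).rank_zero (M ／ M.E) (by omega),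
      (isKLSystem_invKLPoly α).rank_zero (M ↾ ∅) h4, h4] at h
    simp only [mul_one, one_mul, pow_zero, add_zero] at h
    rw [tau, if_pos hM]
    linarith
  · intro F hF
    simp only [Finset.mem_erase, mem_flats] at hF
    obtain ⟨h0, hE, hF⟩ := hF
    have h1 := hF.contract_loopless
    have h2 := M.loopless_restrict hF.subset_ground
    have h3 := M.finite_restrict hF.subset_ground
    have h4 := (isKLSystem_invKLPoly α).two_mul_natDegree_le (M ↾ F)
    have h5 := (isKLSystem_klPoly α).two_mul_natDegree_le (M ／ F)
    have h6 := M.rank_contract_add_rk F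
    have h7 := natDegree_mul_le (p := (M ↾ F).invKLPoly) (q := (M ／ F).klPoly)
    have h8 := M.rk_pos hF.subset_ground h0
    have h9 := hF.rank_contract_pos hE
    obtain ⟨k, hk⟩ := hM
    rw [rank_restrict] at h4
    -- Both ranks are positive here, so twice the degree of the product is at most rk M - 2.
    rw [coeff_eq_zero_of_natDegree_lt (by omega), mul_zero]

/-! ### `ySum` of contractions and deletions -/

theorem delete_restrict_of_notMem (M : Matroid α) {i : α} {F : Set α} (hF : F ⊆ M.E)
    (hi : i ∉ F) : (M ＼ {i}) ↾ F = M ↾ F := by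
  rw [delete_eq_restrict, restrict_restrict_eq M (Set.subset_sdiff_singleton hF hi)]

theorem restrict_deleteElem (M : Matroid α) (i : α) (F : Set α) :
    (M ↾ F) ＼ {i} = M ↾ (F \ {i}) := by
  rw [delete_eq_restrict, restrict_ground_eq, restrict_restrict_eq M Set.sdiff_subset]

/-- After contracting F \ {i} the element i is a loop, so deleting it is the same as contracting it.
-/
theorem deleteElem_contract_sdiff {M : Matroid α} {i : α} {F : Set α} (hi : i ∈ F)
    (h : i ∈ M.closure (F \ {i})) : (M ＼ {i}) ／ (F \ {i}) = M ／ F := by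
  have hl : (M ／ (F \ {i})).IsLoop i :=
    contract_isLoop_iff_mem_closure.2 ⟨h, by simp⟩
  rw [← contract_delete_comm _ Set.disjoint_sdiff_left,
    ← contract_eq_delete_of_subset_loops (Set.singleton_subset_iff.2 hl), contract_contract,
    Set.sdiff_union_of_subset (by simpa using hi)]

open scoped Classical in
theorem ySum_contract (Q : Matroid α → ℤ[X]) (M : Matroid α) [M.Finite] {G : Set α}
    (hG : G ⊆ M.E) :
    ySum Q (M ／ G) = ∑ F ∈ M.flats with G ⊆ F, (M ／ F).yWeight * Q ((M ↾ F) ／ G) := by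
  rw [ySum_eq_sum_yWeight, sum_flats_contract M hG]
  refine Finset.sum_congr rfl fun F hF => ?_
  have h := (Finset.mem_filter.1 hF).2
  rw [contract_contract_sdiff M h, restrict_contract_eq_contract_restrict M h]

open scoped Classical in
theorem ySum_deleteElem (Q : Matroid α → ℤ[X]) (M : Matroid α) [M.Finite] (i : α) :
    ySum Q (M ＼ {i}) =
      ∑ F ∈ M.flats with i ∉ F, ((M ／ F) ＼ {i}).yWeight * Q (M ↾ F) +
        ∑ F ∈ M.tFlats i, (M ／ F).yWeight * Q ((M ↾ F) ＼ {i}) := by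
  rw [ySum_eq_sum_yWeight, sum_flats_deleteElem]
  congr 1 <;> refine Finset.sum_congr rfl fun F hF => ?_
  · simp only [Finset.mem_filter, mem_flats] at hF
    rw [delete_restrict_of_notMem M hF.1.subset_ground hF.2,
      contract_delete_comm _ (by simpa using hF.2)]
  · rw [mem_tFlats] at hF
    rw [restrict_deleteElem, deleteElem_contract_sdiff hF.2.1
      (by rw [closure_sdiff_singleton_eq hF.1 hF.2.2]; exact hF.2.1),
      delete_restrict_of_notMem M (Set.sdiff_subset.trans hF.1.subset_ground) (by simp)]

theorem IsColoop.contractElem_eq_delete {M : Matroid α} {i : α} (hi : M.IsColoop i) :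
    M ／ {i} = M ＼ {i} :=
  contract_eq_delete_of_subset_coloops (Set.singleton_subset_iff.2 hi)

theorem restrict_insert_contractElem {M : Matroid α} {i : α} {F : Set α} (hF : M.IsFlat F)
    (hiF : i ∉ F) (hF' : M.IsFlat (insert i F)) : (M ↾ insert i F) ／ {i} = M ↾ F := by
  have h : (M ↾ insert i F).IsColoop i := by
    rw [isColoop_restrict_iff_isFlat_sdiff hF' (Set.mem_insert i F),
      Set.insert_sdiff_self_of_notMem hiF]
    exact hF
  rw [h.contractElem_eq_delete, restrict_deleteElem, Set.insert_sdiff_self_of_notMem hiF]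

theorem contract_contractElem (M : Matroid α) (i : α) (F : Set α) :
    (M ／ F) ／ {i} = M ／ insert i F := by
  rw [contract_contract, Set.union_singleton]

open scoped Classical in
/-- Reindexing a weighted sum over the flats in which `i` is a coloop by deleting `i` from them. -/
theorem sum_yWeight_insert (Q : Matroid α → ℤ[X]) (M : Matroid α) [M.Finite] {i : α} :
    ∑ F ∈ M.flats with i ∈ F ∧ M.IsFlat (F \ {i}), (M ／ F).yWeight * Q ((M ↾ F) ／ {i}) =
      ∑ F ∈ M.flats with i ∉ F ∧ M.IsFlat (insert i F),
        ((M ／ F) ／ {i}).yWeight * Q (M ↾ F) := by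
  rw [sum_flats_sdiff_eq_sum_flats_insert]
  refine Finset.sum_congr rfl fun F hF => ?_
  simp only [Finset.mem_filter, mem_flats] at hF
  rw [contract_contractElem, restrict_insert_contractElem hF.1 hF.2.1 hF.2.2]

theorem IsFlat.isNonloop_contract {M : Matroid α} {i : α} {F : Set α} (hF : M.IsFlat F)
    (hi : i ∈ M.E) (hiF : i ∉ F) : (M ／ F).IsNonloop i := by
  have := hF.contract_loopless
  exact (M ／ F).isNonloop_of_loopless ⟨hi, hiF⟩

theorem yWeight_contract_contractElem_eq_zero {M : Matroid α} [M.Finite] {i : α} {F : Set α}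
    (hF : M.IsFlat F) (hi : i ∈ M.E) (h : ¬ M.IsFlat (insert i F)) :
    ((M ／ F) ／ {i}).yWeight = 0 := by
  rw [contract_contractElem]
  have hs : insert i F ⊆ M.E := Set.insert_subset hi hF.subset_ground
  rw [isFlat_iff_closure_eq] at h
  obtain ⟨j, hj, hjF⟩ := Set.exists_of_ssubset ((M.subset_closure _ hs).ssubset_of_ne (Ne.symm h))
  exact (contract_isLoop_iff_mem_closure.2 ⟨hj, hjF⟩).yWeight_eq_zero

open scoped Classical in
-- If F ∪ {i} is not a flat, contracting it creates a loop and the weight vanishes. The other terms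
-- are matched by F ↦ F ∪ {i}.
theorem sum_yWeight_contractElem (Q : Matroid α → ℤ[X]) (M : Matroid α) [M.Finite] {i : α}
    (hi : i ∈ M.E) :
    ∑ F ∈ M.flats with i ∉ F, ((M ／ F) ／ {i}).yWeight * Q (M ↾ F) =
      ∑ F ∈ M.flats with i ∈ F ∧ M.IsFlat (F \ {i}),
        (M ／ F).yWeight * Q ((M ↾ F) ／ {i}) := by
  rw [sum_yWeight_insert, ← Finset.filter_filter]
  refine (Finset.sum_filter_of_ne fun F hF h => ?_).symm
  simp only [Finset.mem_filter, mem_flats] at hF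
  by_contra h'
  exact h (by rw [yWeight_contract_contractElem_eq_zero hF.1 hi h', zero_mul])

/-! ### Recognizing Q, and the coloop case -/

/-- If `Q (M | F) = g F` for all proper flats `F`, then `Q M = g E`, provided that `g E` satisfies
the degree bound and that replacing `Q (M | F)` by `g F` in `ySum Q M` yields a palindromic
polynomial. -/
theorem invKLPoly_eq_of_isPalindromic (M : Matroid α) [M.Finite] [M.Loopless]
    (g : Set α → ℤ[X]) (hg : ∀ F, M.IsFlat F → F ≠ M.E → (M ↾ F).invKLPoly = g F)
    (hpos : 0 < M.rank)
    (hdeg : 2 * (g M.E).natDegree < M.rank)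
    (hpal : IsPalindromic M.rank (∑ F ∈ M.flats, (M ／ F).yWeight * g F)) :
    M.invKLPoly = g M.E ∧ M.invZPoly = ∑ F ∈ M.flats, (M ／ F).yWeight * g F := by
  classical
  have h1 : M.invZPoly = M.invKLPoly +
      ∑ F ∈ M.flats.erase M.E, (M ／ F).yWeight * (M ↾ F).invKLPoly := by
    rw [invZPoly, ySum_eq_sum_yWeight, ← Finset.add_sum_erase _ _ M.ground_mem_flats,
      yWeight_contract_ground, one_mul, restrict_ground_eq_self]
  have h2 : ∑ F ∈ M.flats, (M ／ F).yWeight * g F = g M.E +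
      ∑ F ∈ M.flats.erase M.E, (M ／ F).yWeight * (M ↾ F).invKLPoly := by
    rw [← Finset.add_sum_erase _ _ M.ground_mem_flats, yWeight_contract_ground, one_mul]
    congr 1
    refine Finset.sum_congr rfl fun F hF => ?_
    rw [Finset.mem_erase, mem_flats] at hF
    rw [hg F hF.2 hF.1]
  have h3 : M.invKLPoly = g M.E := by
    have h4 := (isKLSystem_invKLPoly α).palindromic M
    rw [h2] at hpal
    rw [← invZPoly, h1] at h4
    -- Both polynomials complete the same sum over proper flats to a palindromic one, and low degree
    -- makes the completion unique.
    exact eq_of_isPalindromic ((isKLSystem_invKLPoly α).degree_lt M hpos) hdeg h4 hpal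
  exact ⟨h3, by rw [h1, h2, h3]⟩

/-- By induction, Q(M|F) may be replaced by Q((M|F)/i) for proper flats F containing i. Doing so for
F = E too turns the sum for Y(M) into (1 + X) Y(M/i), which is palindromic. -/
theorem IsColoop.invKLPoly_contractElem {M : Matroid α} [M.Finite] [M.Loopless] {i : α}
    (hi : M.IsColoop i) : M.invKLPoly = (M ／ {i}).invKLPoly := by
  classical
  induction h : M.E.ncard using Nat.strong_induction_on generalizing M with
  | _ n ih =>
  have hE := hi.mem_ground
  have hl : (M ／ {i}).Loopless := by
    rw [hi.contractElem_eq_delete, delete_eq_restrict]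
    exact M.loopless_restrict Set.sdiff_subset
  have hr := M.rank_contractElem_add_one hi.isNonloop
  have hT : M.tFlats i = ∅ := by
    rw [Finset.eq_empty_iff_forall_notMem]
    intro F hF
    rw [mem_tFlats] at hF
    refine hF.2.2 ((isColoop_restrict_iff_isFlat_sdiff hF.1 hF.2.1).1 ?_)
    rw [restrict_isColoop_iff hF.1.subset_ground, hi.mem_closure_iff_mem]
    exact ⟨by simp, hF.2.1⟩
  have key := (M.invKLPoly_eq_of_isPalindromic
    (fun F => if i ∈ F then ((M ↾ F) ／ {i}).invKLPoly else (M ↾ F).invKLPoly) ?_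
    (by omega) ?_ ?_).1
  · rwa [if_pos hE, restrict_ground_eq_self] at key
  · intro F hF hFE
    split_ifs with hiF
    · have := M.finite_restrict hF.subset_ground
      have := M.loopless_restrict hF.subset_ground
      refine ih _ ?_ (M := M ↾ F) ?_ rfl
      · rw [← h]
        exact Set.ncard_lt_ncard (hF.subset_ground.ssubset_of_ne hFE) M.ground_finite
      · rw [restrict_isColoop_iff hF.subset_ground, hi.mem_closure_iff_mem]
        exact ⟨by simp, hiF⟩
    · rfl
  · rw [if_pos hE, restrict_ground_eq_self]
    have := (isKLSystem_invKLPoly α).two_mul_natDegree_le (M ／ {i})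
    omega
  · have h1 : ∑ F ∈ M.flats, (M ／ F).yWeight *
        (if i ∈ F then ((M ↾ F) ／ {i}).invKLPoly else (M ↾ F).invKLPoly) =
        (1 + X) * ySum invKLPoly (M ／ {i}) := by
      have h2 : ∑ F ∈ M.flats with i ∉ F, (M ／ F).yWeight *
          (if i ∈ F then ((M ↾ F) ／ {i}).invKLPoly else (M ↾ F).invKLPoly) =
          X * ∑ F ∈ M.flats with i ∉ F, ((M ／ F) ／ {i}).yWeight * (M ↾ F).invKLPoly := by
        rw [Finset.mul_sum]
        refine Finset.sum_congr rfl fun F hF => ?_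
        simp only [Finset.mem_filter, mem_flats] at hF
        rw [if_neg hF.2, (contract_isColoop_iff.2 ⟨hi, hF.2⟩).yWeight_eq, mul_assoc]
      have h3 : ∀ F ∈ M.flats.filter (fun F => i ∈ F ∧ M.IsFlat (F \ {i})), (M ／ F).yWeight *
          (if i ∈ F then ((M ↾ F) ／ {i}).invKLPoly else (M ↾ F).invKLPoly) =
          (M ／ F).yWeight * ((M ↾ F) ／ {i}).invKLPoly := by
        intro F hF
        rw [if_pos (Finset.mem_filter.1 hF).2.1]
      rw [sum_flats_eq_add_add M i, h2, sum_yWeight_contractElem _ M hE, Finset.sum_congr rfl h3,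
        hT, Finset.sum_empty, ySum_contract _ M (Set.singleton_subset_iff.2 hE)]
      simp only [Set.singleton_subset_iff]
      rw [sum_flats_mem_eq_add, hT, Finset.sum_empty]
      ring
    rw [h1, ← hr, add_comm]
    exact IsPalindromic.one_add_X.mul ((isKLSystem_invKLPoly α).palindromic _)

/-! ### The deletion formula summed over all flats -/

open scoped Classical in
/-- The right-hand side of the deletion formula for the inverse Kazhdan--Lusztig polynomial of
the restriction of `M` to a flat `F`. -/
noncomputable def deletionFormula (M : Matroid α) [M.Finite] (i : α) (F : Set α) : ℤ[X] :=
  ((M ↾ F) ＼ {i}).invKLPoly + (1 + X) * ((M ↾ F) ／ {i}).invKLPoly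
    - ∑ G ∈ M.tFlats i with G ⊆ F,
        C ((M ↾ G) ／ {i}).tau * X ^ (M.rk G / 2) * ((M ↾ F) ／ G).invKLPoly

theorem deletionFormula_ground (M : Matroid α) [M.Finite] (i : α) :
    M.deletionFormula i M.E = (M ＼ {i}).invKLPoly + (1 + X) * (M ／ {i}).invKLPoly
        - ∑ F ∈ M.tFlats i,
            C ((M ↾ F) ／ {i}).tau * X ^ (M.rk F / 2) * (M ／ F).invKLPoly := by
  classical
  rw [deletionFormula, restrict_ground_eq_self, Finset.filter_true_of_mem]
  intro F hF
  exact (mem_tFlats.1 hF).1.subset_ground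

theorem deletionFormula_restrict_ground {M : Matroid α} [M.Finite] (i : α) {F : Set α}
    (hF : M.IsFlat F) [(M ↾ F).Finite] :
    (M ↾ F).deletionFormula i F = M.deletionFormula i F := by
  rw [deletionFormula, deletionFormula, hF.tFlats_restrict, restrict_restrict_eq M subset_rfl]
  classical
  refine congrArg₂ (· - ·) rfl (Finset.sum_congr (by ext; simp) fun G hG => ?_)
  have hGF := (Finset.mem_filter.1 hG).2
  rw [restrict_restrict_eq M hGF, M.rk_restrict hGF]

/-- From i ∈ closure (G \ {i}) it follows that i ∈ closure (F \ {i}). -/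
theorem mem_tFlats_of_subset {M : Matroid α} [M.Finite] {i : α} {F G : Set α}
    (hG : G ∈ M.tFlats i) (hF : M.IsFlat F) (hGF : G ⊆ F) : F ∈ M.tFlats i := by
  rw [mem_tFlats] at hG ⊢
  refine ⟨hF, hGF hG.2.1, fun h => ?_⟩
  have h1 := h.closure_subset (Set.sdiff_subset_sdiff_left hGF)
  rw [closure_sdiff_singleton_eq hG.1 hG.2.2] at h1
  exact (h1 hG.2.1).2 rfl

theorem ground_mem_tFlats_iff {M : Matroid α} [M.Finite] {i : α} (hi : i ∈ M.E) :
    M.E ∈ M.tFlats i ↔ ¬ M.IsColoop i := by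
  rw [mem_tFlats, ← isColoop_restrict_iff_isFlat_sdiff M.ground_isFlat hi, restrict_ground_eq_self]
  exact ⟨fun h => h.2.2, fun h => ⟨M.ground_isFlat, hi, h⟩⟩

open scoped Classical in
-- Flats avoiding i: the weight rule gives part of Y(M\i) and X·a, where a is the sum over coloop
-- flats of weight times Q((M|F)/i). The coloop flats contribute a again. The flats in T supply the
-- rest of Y(M\i), the rest of (1 + X) Y(M/i), and the τ-terms.
theorem sum_yWeight_mul_deletionFormula (M : Matroid α) [M.Finite] [M.Loopless] {i : α}
    (hi : i ∈ M.E) (hc : ¬ M.IsColoop i) :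
    ∑ F ∈ M.flats, (M ／ F).yWeight *
        (if F ∈ M.tFlats i then M.deletionFormula i F else (M ↾ F).invKLPoly) =
      (M ＼ {i}).invZPoly + (1 + X) * (M ／ {i}).invZPoly
        - ∑ F ∈ M.tFlats i,
            C ((M ↾ F) ／ {i}).tau * X ^ (M.rk F / 2) * (M ／ F).invZPoly := by
  have h1 : ∑ F ∈ M.flats with i ∉ F, (M ／ F).yWeight *
      (if F ∈ M.tFlats i then M.deletionFormula i F else (M ↾ F).invKLPoly) =
      ∑ F ∈ M.flats with i ∉ F, ((M ／ F) ＼ {i}).yWeight * (M ↾ F).invKLPoly +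
        X * ∑ F ∈ M.flats with i ∉ F, ((M ／ F) ／ {i}).yWeight * (M ↾ F).invKLPoly := by
    rw [Finset.mul_sum, ← Finset.sum_add_distrib]
    refine Finset.sum_congr rfl fun F hF => ?_
    simp only [Finset.mem_filter, mem_flats] at hF
    rw [if_neg fun h => hF.2 (mem_tFlats.1 h).2.1,
      (hF.1.isNonloop_contract hi hF.2).yWeight_eq fun h => hc (contract_isColoop_iff.1 h).1]
    ring
  have h2 : ∑ F ∈ M.flats with i ∈ F ∧ M.IsFlat (F \ {i}), (M ／ F).yWeight *
      (if F ∈ M.tFlats i then M.deletionFormula i F else (M ↾ F).invKLPoly) =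
      ∑ F ∈ M.flats with i ∈ F ∧ M.IsFlat (F \ {i}),
        (M ／ F).yWeight * ((M ↾ F) ／ {i}).invKLPoly := by
    refine Finset.sum_congr rfl fun F hF => ?_
    simp only [Finset.mem_filter, mem_flats] at hF
    obtain ⟨hF, hiF, hF'⟩ := hF
    have := M.finite_restrict hF.subset_ground
    have := M.loopless_restrict hF.subset_ground
    rw [if_neg fun h => (mem_tFlats.1 h).2.2 hF',
      ((isColoop_restrict_iff_isFlat_sdiff hF hiF).2 hF').invKLPoly_contractElem]
  have h3 : ∑ F ∈ M.tFlats i, (M ／ F).yWeight *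
      (if F ∈ M.tFlats i then M.deletionFormula i F else (M ↾ F).invKLPoly) =
      ∑ F ∈ M.tFlats i, (M ／ F).yWeight * ((M ↾ F) ＼ {i}).invKLPoly +
      (1 + X) * ∑ F ∈ M.tFlats i, (M ／ F).yWeight * ((M ↾ F) ／ {i}).invKLPoly -
      ∑ F ∈ M.tFlats i, ∑ G ∈ M.tFlats i with G ⊆ F, C ((M ↾ G) ／ {i}).tau *
        X ^ (M.rk G / 2) * ((M ／ F).yWeight * ((M ↾ F) ／ G).invKLPoly) := by
    rw [Finset.mul_sum, ← Finset.sum_add_distrib, ← Finset.sum_sub_distrib]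
    refine Finset.sum_congr rfl fun F hF => ?_
    rw [if_pos hF, deletionFormula, mul_sub, Finset.mul_sum]
    refine congrArg₂ (· - ·) ?_ ?_
    · rw [mul_add, mul_left_comm]
    · refine Finset.sum_congr rfl fun G _ => ?_
      rw [mul_left_comm]
  have h4 : ∑ F ∈ M.tFlats i, ∑ G ∈ M.tFlats i with G ⊆ F, C ((M ↾ G) ／ {i}).tau *
        X ^ (M.rk G / 2) * ((M ／ F).yWeight * ((M ↾ F) ／ G).invKLPoly) =
      ∑ G ∈ M.tFlats i,
        C ((M ↾ G) ／ {i}).tau * X ^ (M.rk G / 2) * (M ／ G).invZPoly := by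
    -- As `tFlats` is closed upwards, for fixed G the inner sum runs over all flats above G and is
    -- Y(M/G).
    rw [Finset.sum_comm' (t' := M.tFlats i) (s' := fun G => M.flats.filter (G ⊆ ·))]
    · refine Finset.sum_congr rfl fun G hG => ?_
      rw [invZPoly, ySum_contract _ M (mem_tFlats.1 hG).1.subset_ground, Finset.mul_sum]
    · intro F G
      simp only [Finset.mem_filter, mem_flats]
      constructor
      · rintro ⟨hF, hG, hGF⟩
        exact ⟨⟨(mem_tFlats.1 hF).1, hGF⟩, hG⟩
      · rintro ⟨⟨hF, hGF⟩, hG⟩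
        exact ⟨mem_tFlats_of_subset hG hF hGF, hG, hGF⟩
  rw [sum_flats_eq_add_add M i, h1, h2, h3, h4, sum_yWeight_contractElem _ M hi, invZPoly,
    invZPoly, ySum_deleteElem, ySum_contract _ M (Set.singleton_subset_iff.2 hi)]
  simp only [Set.singleton_subset_iff]
  rw [sum_flats_mem_eq_add]
  generalize (∑ F ∈ M.flats with i ∈ F ∧ M.IsFlat (F \ {i}),
    (M ／ F).yWeight * ((M ↾ F) ／ {i}).invKLPoly) = a
  generalize (∑ F ∈ M.tFlats i, (M ／ F).yWeight * ((M ↾ F) ／ {i}).invKLPoly) = b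
  generalize (∑ F ∈ M.tFlats i, (M ／ F).yWeight * ((M ↾ F) ＼ {i}).invKLPoly) = c
  ring

/-! ### Palindromicity and degree of the right-hand sides -/

theorem invKLPoly_eq_zero_of_not_loopless {M : Matroid α} (h : ¬ M.Loopless) :
    M.invKLPoly = 0 :=
  (isKLSystem_invKLPoly α).eq_zero M fun h' => h h'.2

theorem invZPoly_eq_zero_of_not_loopless {M : Matroid α} [M.Finite] (h : ¬ M.Loopless) :
    M.invZPoly = 0 := by
  rw [loopless_iff_forall_not_isLoop] at h
  push Not at h
  obtain ⟨i, hiE, hi⟩ := h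
  refine Finset.sum_eq_zero fun F hF => ?_
  rw [invKLPoly_eq_zero_of_not_loopless, mul_zero]
  intro h
  rw [mem_flats] at hF
  have hiF : i ∈ F := by
    rw [← hF.closure]
    exact M.closure_subset_closure (Set.empty_subset F) hi
  have h1 := (M ↾ F).isNonloop_of_loopless (e := i) hiF
  rw [restrict_isNonloop_iff] at h1
  exact h1.1.not_isLoop hi

theorem isPalindromic_deletionFormula (M : Matroid α) [M.Finite] [M.Loopless] {i : α}
    (hi : i ∈ M.E) (hc : ¬ M.IsColoop i) :
    IsPalindromic M.rank ((M ＼ {i}).invZPoly + (1 + X) * (M ／ {i}).invZPoly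
        - ∑ F ∈ M.tFlats i,
            C ((M ↾ F) ／ {i}).tau * X ^ (M.rk F / 2) * (M ／ F).invZPoly) := by
  have hpal := (isKLSystem_invKLPoly α).palindromic
  have hr := M.rank_contractElem_add_one (M.isNonloop_of_loopless hi)
  refine (IsPalindromic.add ?_ ?_).sub (IsPalindromic.sum fun F hF => ?_)
  · have : (M ＼ {i}).Loopless := M.loopless_restrict Set.sdiff_subset
    rw [← rank_deleteElem M hc]
    exact hpal _
  · by_cases h : (M ／ {i}).Loopless
    · rw [← hr, add_comm]
      exact IsPalindromic.one_add_X.mul (hpal _)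
    · rw [invZPoly_eq_zero_of_not_loopless h, mul_zero]
      exact IsPalindromic.zero
  · rw [mem_tFlats] at hF
    obtain ⟨hF, hiF, -⟩ := hF
    have := hF.contract_loopless
    have := M.finite_restrict hF.subset_ground
    have := M.loopless_restrict hF.subset_ground
    have h1 := (M ↾ F).rank_contractElem_add_one ((M ↾ F).isNonloop_of_loopless hiF)
    rw [rank_restrict] at h1
    by_cases h : Odd ((M ↾ F) ／ {i}).rank
    · obtain ⟨k, hk⟩ := h
      -- A nonzero τ forces rk F to be even, so no rank is lost to the rounding in rk F / 2.
      have h2 : M.rank = 0 + 2 * (M.rk F / 2) + (M ／ F).rank := by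
        have := M.rank_contract_add_rk F
        omega
      rw [h2]
      exact ((IsPalindromic.C _).mul (IsPalindromic.X_pow _)).mul (hpal _)
    · rw [tau, if_neg h, C_0, zero_mul, zero_mul]
      exact IsPalindromic.zero

theorem tau_eq_zero_of_not_loopless {M : Matroid α} (h : ¬ M.Loopless) : M.tau = 0 := by
  rw [tau, (isKLSystem_klPoly α).eq_zero M fun h' => h h'.2, coeff_zero, ite_self]

/-- In odd rank the one offending coefficient of (1 + X) Q is the middle coefficient of Q, which is
τ; in even positive rank there is none. Rank zero without loops is excluded, since there 1 + X
itself is too large. -/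
theorem two_mul_natDegree_one_add_X_mul_sub_lt (M : Matroid α) [M.Finite]
    (hM : M.Loopless → 0 < M.rank) :
    2 * ((1 + X) * M.invKLPoly - C M.tau * X ^ ((M.rank + 1) / 2)).natDegree < M.rank + 1 := by
  by_cases hl : M.Loopless
  swap
  · rw [invKLPoly_eq_zero_of_not_loopless hl, tau_eq_zero_of_not_loopless hl]
    simp
  have hd := (isKLSystem_invKLPoly α).two_mul_natDegree_le M
  refine (Nat.mul_le_mul_left 2 (natDegree_le_iff_coeff_eq_zero (n := M.rank / 2).2
    fun j hj => ?_)).trans_lt (by omega)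
  obtain ⟨j, rfl⟩ : ∃ k, j = k + 1 := ⟨j - 1, by omega⟩
  rw [add_mul, one_mul, coeff_sub, coeff_add, coeff_X_mul, coeff_C_mul, coeff_X_pow,
    coeff_eq_zero_of_natDegree_lt (p := M.invKLPoly) (n := j + 1) (by omega), zero_add]
  by_cases ho : Odd M.rank
  · rw [tau_eq_coeff_invKLPoly M ho]
    obtain ⟨k, hk⟩ := ho
    split_ifs with h
    · rw [show (M.rank - 1) / 2 = j by omega, mul_one, sub_self]
    · rw [coeff_eq_zero_of_natDegree_lt (by omega), mul_zero, sub_self]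
  · rw [tau, if_neg ho, zero_mul, sub_zero]
    rw [Nat.not_odd_iff_even] at ho
    obtain ⟨k, hk⟩ := ho
    have := hM hl
    exact coeff_eq_zero_of_natDegree_lt (p := M.invKLPoly) (n := j) (by omega)

/-- If the contraction is loopless then {i} is a flat. It is not E, since otherwise ∅ would span and
i would be a loop. -/
theorem rank_contractElem_pos {M : Matroid α} [M.Finite] [M.Loopless] {i : α} (hi : i ∈ M.E)
    (hc : ¬ M.IsColoop i) (hl : (M ／ {i}).Loopless) : 0 < (M ／ {i}).rank := by
  have hs : {i} ⊆ M.E := Set.singleton_subset_iff.2 hi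
  have h := (M ／ {i}).loops_eq_empty
  rw [contract_loops_eq, Set.sdiff_eq_empty] at h
  have hF : M.IsFlat {i} := isFlat_iff_closure_eq.2 (h.antisymm (M.subset_closure _ hs))
  refine hF.rank_contract_pos fun hE => ?_
  rw [isColoop_iff_sdiff_not_spanning, not_not, ← hE, Set.sdiff_self] at hc
  have h1 := hc.closure_eq
  exact M.not_isLoop i (show i ∈ M.closure ∅ from h1 ▸ hi)

theorem two_mul_natDegree_deletionFormula_lt (M : Matroid α) [M.Finite] [M.Loopless] {i : α}
    (hi : i ∈ M.E) (hc : ¬ M.IsColoop i) : 2 * (M.deletionFormula i M.E).natDegree < M.rank := by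
  classical
  have hr := M.rank_contractElem_add_one (M.isNonloop_of_loopless hi)
  have h0 := M.ground_isFlat.contract_loopless
  have h0' := M.rank_contract_add_rk M.E
  rw [rk_ground] at h0'
  -- The summand F = E is split off to be paired with (1 + X) Q(M/i); every other term satisfies the
  -- degree bound by itself.
  rw [deletionFormula_ground, ← Finset.add_sum_erase _ _ ((ground_mem_tFlats_iff hi).2 hc),
    restrict_ground_eq_self, rk_ground,
    (isKLSystem_invKLPoly α).rank_zero (M ／ M.E) (by omega), mul_one, ← sub_sub]
  suffices h : ((M ＼ {i}).invKLPoly + ((1 + X) * (M ／ {i}).invKLPoly -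
      C (M ／ {i}).tau * X ^ (M.rank / 2)) - ∑ F ∈ (M.tFlats i).erase M.E,
        C ((M ↾ F) ／ {i}).tau * X ^ (M.rk F / 2) * (M ／ F).invKLPoly).natDegree
        ≤ (M.rank - 1) / 2 by
    have : 0 < M.rank := by omega
    refine (Nat.mul_le_mul_left 2 ?_).trans_lt (show 2 * ((M.rank - 1) / 2) < M.rank by omega)
    rwa [← add_sub_assoc] at h
  refine (natDegree_sub_le _ _).trans (max_le (natDegree_add_le_of_degree_le ?_ ?_)
    (natDegree_sum_le_of_forall_le _ _ fun F hF => ?_))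
  · have : (M ＼ {i}).Loopless := M.loopless_restrict Set.sdiff_subset
    have := (isKLSystem_invKLPoly α).two_mul_natDegree_le (M ＼ {i})
    rw [rank_deleteElem M hc] at this
    omega
  · have := (M ／ {i}).two_mul_natDegree_one_add_X_mul_sub_lt
      (rank_contractElem_pos hi hc)
    rw [hr] at this
    omega
  · rw [Finset.mem_erase, mem_tFlats] at hF
    obtain ⟨hFE, hF, -⟩ := hF
    have := hF.contract_loopless
    have h1 := (isKLSystem_invKLPoly α).two_mul_natDegree_le (M ／ F)
    have h2 := hF.rank_contract_pos hFE
    have h3 := M.rank_contract_add_rk F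
    have h4 := natDegree_C_mul_X_pow_le ((M ↾ F) ／ {i}).tau (M.rk F / 2)
    refine natDegree_mul_le.trans ?_
    omega

theorem invKLPoly_eq_deletionFormula (M : Matroid α) [M.Finite] [M.Loopless] {i : α}
    (hi : i ∈ M.E) (hc : ¬ M.IsColoop i) :
    M.invKLPoly = M.deletionFormula i M.E ∧
      M.invZPoly = (M ＼ {i}).invZPoly + (1 + X) * (M ／ {i}).invZPoly
        - ∑ F ∈ M.tFlats i,
            C ((M ↾ F) ／ {i}).tau * X ^ (M.rk F / 2) * (M ／ F).invZPoly := by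
  classical
  induction h : M.E.ncard using Nat.strong_induction_on generalizing M with
  | _ n ih =>
  have key := M.invKLPoly_eq_of_isPalindromic
    (fun F => if F ∈ M.tFlats i then M.deletionFormula i F else (M ↾ F).invKLPoly) ?_
    (M.rank_pos (M.isNonloop_of_loopless hi)) ?_ ?_
  · rwa [if_pos ((ground_mem_tFlats_iff hi).2 hc), sum_yWeight_mul_deletionFormula M hi hc] at key
  · intro F hF hFE
    split_ifs with hT
    · rw [mem_tFlats] at hT
      have := M.finite_restrict hF.subset_ground
      have := M.loopless_restrict hF.subset_ground
      -- i is not a coloop of M|F, so the induction hypothesis applies to M|F.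
      rw [← deletionFormula_restrict_ground i hF]
      refine (ih _ ?_ (M ↾ F) hT.2.1 ?_ rfl).1
      · rw [← h]
        exact Set.ncard_lt_ncard (hF.subset_ground.ssubset_of_ne hFE) M.ground_finite
      · rw [isColoop_restrict_iff_isFlat_sdiff hF hT.2.1]
        exact hT.2.2
    · rfl
  · rw [if_pos ((ground_mem_tFlats_iff hi).2 hc)]
    exact M.two_mul_natDegree_deletionFormula_lt hi hc
  · rw [sum_yWeight_mul_deletionFormula M hi hc]
    exact M.isPalindromic_deletionFormula hi hc

end Matroid

theorem theorem1p2 {α : Type*} (M : Matroid α) [M.Finite] [M.Loopless] (i : α) (hi : i ∈ M.E)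
    (hcoloop : ¬ M.IsColoop i) :
    M.invKLPoly = (M ＼ {i}).invKLPoly + (1 + X) * (M ／ {i}).invKLPoly
        - ∑ F ∈ M.tFlats i,
            C ((M ↾ F) ／ {i}).tau * X ^ (M.rk F / 2) * (M ／ F).invKLPoly ∧
    M.invZPoly = (M ＼ {i}).invZPoly + (1 + X) * (M ／ {i}).invZPoly
        - ∑ F ∈ M.tFlats i,
            C ((M ↾ F) ／ {i}).tau * X ^ (M.rk F / 2) * (M ／ F).invZPoly := by
  have h := M.invKLPoly_eq_deletionFormula hi hcoloop
  rwa [Matroid.deletionFormula_ground] at h
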